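/- Let $\mathbb K$ be a field of characteristic zero and let $d\ge 1$. **Binomial sums.** For $n,k\in\mathbb Z$ let $\binom nk=\frac{n(n-1)\cdots(n-k+1)}{k!}$ if $k\ge 0$ and $\binom nk=0$ if $k<0$. For $a,b\in\mathbb Z$ let the directed sum $\sum'^{\,b}_{k=a}u_k$ be $\sum_{k=a}^b u_k$ if $a\le b$, $0$ if $a=b+1$, and $-\sum_{k=b+1}^{a-1}u_k$ if $a>b+1$. Let $\mathcal S$ be the $\mathbb K$-algebra (with pointwise operations) of the functions $\mathbb Z^{\mathbb N}\to\mathbb K$ that depend only on the first $e$ coordinates for some $e$; a sequence $\mathbb Z^e\to\mathbb K$ is identified with the corresponding element of $\mathcal S$, and for $u\in\mathcal S$ and $n\in\mathbb Z^e$ write $u_n=u(n_1,\dots,n_e,0,0,\dots)$. The algebra $\mathcal B$ of binomial sums is the smallest subalgebra of $\mathcal S$ that contains the Kronecker delta $n\in\mathbb Z\mapsto\delta_n$, the geometric sequences $n\in\mathbb Z\mapsto C^n$ ($C\in\mathbb K\setminus\{0\}$) and $(n,k)\in\mathbb Z^2\mapsto\binom nk$, and such that for every $u\in\mathcal B$ it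 contains $n\in\mathbb Z^{e}\mapsto u_{\lambda(n)}$ for every affine map $\lambda:\mathbb Z^{e}\to\mathbb Z^{e'}$, and $(n,m)\in\mathbb Z^{e}\times\mathbb Z\mapsto\sum'^{\,m}_{k=0}u_{n,k}$. A sequence $u:\mathbb N^d\to\mathbb K$ is called a binomial sum if there is a sequence $v:\mathbb Z^d\to\mathbb K$ in $\mathcal B$ whose support is contained in $\mathbb N^d$ and which coincides with $u$ on $\mathbb N^d$. **Coefficients of rational functions.** For $r\in\mathbb N$, the notation $t_1\prec\dots\prec t_d\prec z_1\prec\dots\prec z_r$ means that rational functions in these variables are expanded in the field of iterated Laurent series $\mathbb K((z_r))\cdots((z_1))((t_d))\cdots((t_1))$, that is, the field of formal series in monomials $t^nz^m$, $(n,m)\in\mathbb Z^{d+r}$, whose support is well-ordered for the lexicographic order on $\mathbb Z^{d+r}$; and $[t^nz^0]R$ denotes the coefficient of $t_1^{n_1}\cdots t_d^{n_d}z_1^0\cdots z_r^0$ in the expansion of $R$. **Proposition.** A sequence $u:\mathbb N^d\to\mathbb K$ is a binomial sum if and only if there exist $r\in\mathbb N$ and a rational function $R\in\mathbb K(t_1,\dots,t_d,z_1,\dots,z_r)$,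 with $t_1\prec\dots\prec t_d\prec z_1\prec\dots\prec z_r$, such that, for all $n\in\mathbb Z^d$, $$[t^nz^0]R=\begin{cases}u_n&\text{if } n\in\mathbb N^d,\\ 0&\text{otherwise.}\end{cases}$$ -/

import Mathlib

namespace BinomialSums

/-! ### Binomial coefficients and directed sums -/

/-- The binomial coefficient `n.choose k` for all integers `n`, `k`: it is
`n (n - 1) ⋯ (n - k + 1) / k!` if `0 ≤ k`, and `0` if `k < 0`. -/
def intChoose (n k : ℤ) : ℤ :=
  if 0 ≤ k then Ring.choose n k.toNat else 0

/-- The directed sum of `f k` for `k` from `a` to `b`: it is the usual sum if `a ≤ b`, it is `0` if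
`a = b + 1`, and it is minus the sum from `b + 1` to `a - 1` if `a > b + 1`. -/
noncomputable def directedSum {M : Type*} [AddCommGroup M] (a b : ℤ) (f : ℤ → M) : M :=
  if a ≤ b then ∑ k ∈ Finset.Icc a b, f k else -∑ k ∈ Finset.Icc (b + 1) (a - 1), f k

/-! ### The algebra of sequences and the algebra of binomial sums -/

/-- The first `d` coordinates of a point of `ℤ^ℕ`. -/
def restrictIndex (d : ℕ) (x : ℕ → ℤ) : Fin d → ℤ := fun i => x i

/-- A point of `ℤ^d`, extended by zeros to a point of `ℤ^ℕ`. -/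
def extendIndex {d : ℕ} (n : Fin d → ℤ) : ℕ → ℤ := fun i => if h : i < d then n ⟨i, h⟩ else 0

/-- A sequence indexed by `ℤ^d`, seen as a function on `ℤ^ℕ` of the first `d` coordinates. -/
def liftSeq {K : Type*} {d : ℕ} (u : (Fin d → ℤ) → K) : (ℕ → ℤ) → K :=
  fun x => u (restrictIndex d x)

/-- The restriction to `ℤ^d` of a function on `ℤ^ℕ`: the missing indices are set to `0`. -/
def restrictSeq {K : Type*} (d : ℕ) (u : (ℕ → ℤ) → K) : (Fin d → ℤ) → K :=
  fun n => u (extendIndex n)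

/-- The algebra of all sequences in finitely many integer indices: the union, over `d`, of the
algebras of functions `ℤ^d → K`, inside the algebra of functions `ℤ^ℕ → K`. -/
def sequences (K : Type*) [Field K] : Subalgebra K ((ℕ → ℤ) → K) where
  carrier := {u | ∃ (d : ℕ) (v : (Fin d → ℤ) → K), u = liftSeq v}
  mul_mem' := by
    rintro _ _ ⟨d, v, rfl⟩ ⟨e, w, rfl⟩
    exact ⟨max d e, fun n => v (fun i => n (Fin.castLE (le_max_left d e) i)) *
      w (fun i => n (Fin.castLE (le_max_right d e) i)), rfl⟩
  add_mem' := by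
    rintro _ _ ⟨d, v, rfl⟩ ⟨e, w, rfl⟩
    exact ⟨max d e, fun n => v (fun i => n (Fin.castLE (le_max_left d e) i)) +
      w (fun i => n (Fin.castLE (le_max_right d e) i)), rfl⟩
  algebraMap_mem' := fun c => ⟨0, fun _ => c, rfl⟩

/-- The closure properties in the definition of binomial sums. -/
structure IsBinomialClosed {K : Type*} [Field K] (A : Subalgebra K ((ℕ → ℤ) → K)) : Prop where
  /-- The Kronecker delta sequence. -/
  delta : liftSeq (fun n : Fin 1 → ℤ => if n 0 = 0 then (1 : K) else 0) ∈ A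
  /-- The geometric sequences. -/
  geom : ∀ C : K, C ≠ 0 → liftSeq (fun n : Fin 1 → ℤ => C ^ n 0) ∈ A
  /-- The binomial sequence. -/
  binom : liftSeq (fun n : Fin 2 → ℤ => ((intChoose (n 0) (n 1) : ℤ) : K)) ∈ A
  /-- Affine changes of indices. -/
  affine : ∀ (d e : ℕ) (f : (Fin d → ℤ) →ᵃ[ℤ] (Fin e → ℤ)), ∀ u ∈ A,
    liftSeq (fun n : Fin d → ℤ => restrictSeq e u (f n)) ∈ A
  /-- Directed indefinite sums over the last index. -/
  sum : ∀ d : ℕ, ∀ u ∈ A,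
    liftSeq (fun n : Fin (d + 1) → ℤ =>
      directedSum 0 (n (Fin.last d)) fun k => restrictSeq (d + 1) u (Fin.snoc (Fin.init n) k)) ∈ A

/-- The algebra of binomial sums over `K`. -/
def binomialSums (K : Type*) [Field K] : Subalgebra K ((ℕ → ℤ) → K) :=
  sInf {A | A ≤ sequences K ∧ IsBinomialClosed A}

theorem isBinomialClosed_sequences (K : Type*) [Field K] : IsBinomialClosed (sequences K) where
  delta := ⟨1, _, rfl⟩
  geom := fun _ _ => ⟨1, _, rfl⟩
  binom := ⟨2, _, rfl⟩
  affine := fun d _ _ _ _ => ⟨d, _, rfl⟩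
  sum := fun d _ _ => ⟨d + 1, _, rfl⟩

/-- The algebra of binomial sums is indeed the smallest one with the closure properties. -/
theorem isLeast_binomialSums (K : Type*) [Field K] :
    IsLeast {A | A ≤ sequences K ∧ IsBinomialClosed A} (binomialSums K) := by
  refine ⟨⟨sInf_le ⟨le_rfl, isBinomialClosed_sequences K⟩, ?_⟩, fun A hA => sInf_le hA⟩
  have key : ∀ u : (ℕ → ℤ) → K, u ∈ binomialSums K ↔
      ∀ A : Subalgebra K ((ℕ → ℤ) → K), A ≤ sequences K ∧ IsBinomialClosed A → u ∈ A :=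
    fun u => Algebra.mem_sInf
  exact
    { delta := (key _).2 fun A hA => hA.2.delta
      geom := fun C hC => (key _).2 fun A hA => hA.2.geom C hC
      binom := (key _).2 fun A hA => hA.2.binom
      affine := fun d e f u hu => (key _).2 fun A hA => hA.2.affine d e f u ((key u).1 hu A hA)
      sum := fun d u hu => (key _).2 fun A hA => hA.2.sum d u ((key u).1 hu A hA) }

/-- A sequence `ℤ^d → K` is a binomial sum. -/
def IsBinomialSum {K : Type*} [Field K] {d : ℕ} (u : (Fin d → ℤ) → K) : Prop :=
  liftSeq u ∈ binomialSums K

/-- A sequence `ℕ^d → K` is a binomial sum if it is the restriction to `ℕ^d` of a binomial sum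
`ℤ^d → K` whose support is contained in `ℕ^d`. -/
def IsNatBinomialSum {K : Type*} [Field K] {d : ℕ} (u : (Fin d → ℕ) → K) : Prop :=
  ∃ v : (Fin d → ℤ) → K, IsBinomialSum v ∧ (∀ n : Fin d → ℕ, v (fun i => (n i : ℤ)) = u n) ∧
    ∀ n : Fin d → ℤ, v n ≠ 0 → ∀ i, 0 ≤ n i

open Classical in
/-- The extension by zero to `ℤ^d` of a sequence `ℕ^d → K`. -/
noncomputable def extendByZero {K : Type*} [Field K] {d : ℕ} (u : (Fin d → ℕ) → K) :
    (Fin d → ℤ) → K :=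
  fun n => if ∀ i, 0 ≤ n i then u (fun i => (n i).toNat) else 0

/-! ### Iterated Laurent series and the coefficients of rational functions -/

/-- The field of iterated Laurent series `K((z_m))⋯((z_1))` in ordered variables
`z_1 ≺ ⋯ ≺ z_m`, as the field of Hahn series whose exponents form the group `ℤ^m` with the
lexicographic order, the first coordinate being the most significant one. -/
abbrev IteratedLaurent (K : Type*) [Field K] (m : ℕ) : Type _ :=
  HahnSeries (Lex (Fin m → ℤ)) K

/-- The coefficient `[z^n] f` of the monomial `z_1^{n_1} ⋯ z_m^{n_m}` in `f`. -/
def IteratedLaurent.coeffAt {K : Type*} [Field K] {m : ℕ} (n : Fin m → ℤ)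
    (f : IteratedLaurent K m) : K :=
  f.coeff (toLex n)

/-- The variable `z_i` in the field of iterated Laurent series. -/
noncomputable def IteratedLaurent.var (K : Type*) [Field K] {m : ℕ} (i : Fin m) :
    IteratedLaurent K m :=
  HahnSeries.single (toLex (Pi.single i 1)) 1

/-- The morphism of `K`-algebras from polynomials to iterated Laurent series that sends each
variable to itself. -/
noncomputable def polyToLaurent (K : Type*) [Field K] (m : ℕ) :
    MvPolynomial (Fin m) K →ₐ[K] IteratedLaurent K m :=
  MvPolynomial.aeval (IteratedLaurent.var K)

theorem prod_single_one {K : Type*} [Field K] {m : ℕ} {ι : Type*} (s : Finset ι)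
    (f : ι → Lex (Fin m → ℤ)) :
    ∏ i ∈ s, (HahnSeries.single (f i) (1 : K)) = HahnSeries.single (∑ i ∈ s, f i) 1 := by
  classical
  induction s using Finset.induction_on with
  | empty => simp
  | insert a s ha ih => rw [Finset.prod_insert ha, Finset.sum_insert ha, ih]; simp

theorem polyToLaurent_monomial {K : Type*} [Field K] {m : ℕ} (s : Fin m →₀ ℕ) (c : K) :
    polyToLaurent K m (MvPolynomial.monomial s c) =
      HahnSeries.single (toLex fun i => (s i : ℤ)) c := by
  have h : (∑ i, s i • toLex (Pi.single i (1 : ℤ)) : Lex (Fin m → ℤ)) =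
      toLex fun i => (s i : ℤ) := by
    have h' : (∑ i, s i • (Pi.single i (1 : ℤ)) : Fin m → ℤ) = fun i => (s i : ℤ) := by
      ext j
      simp [Finset.sum_apply, Pi.single_apply]
    exact h'
  rw [polyToLaurent, MvPolynomial.aeval_monomial, Finsupp.prod_fintype _ _ (by simp)]
  simp only [IteratedLaurent.var, HahnSeries.single_pow, one_pow]
  rw [prod_single_one, h, HahnSeries.algebraMap_apply]
  simp

/-- On polynomials, the coefficients in the field of iterated Laurent series are the usual ones. -/
theorem coeff_polyToLaurent {K : Type*} [Field K] {m : ℕ} (p : MvPolynomial (Fin m) K)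
    (s : Fin m →₀ ℕ) : (polyToLaurent K m p).coeffAt (fun i => (s i : ℤ)) = p.coeff s := by
  classical
  unfold IteratedLaurent.coeffAt
  induction p using MvPolynomial.induction_on' with
  | monomial t c =>
    rw [polyToLaurent_monomial, MvPolynomial.coeff_monomial, HahnSeries.coeff_single]
    congr 1
    apply propext
    rw [toLex_inj, funext_iff, Finsupp.ext_iff]
    exact ⟨fun h i => (Int.ofNat_inj.1 (h i)).symm, fun h i => congrArg _ (h i).symm⟩
  | add p q hp hq => rw [map_add, HahnSeries.coeff_add, hp, hq, MvPolynomial.coeff_add]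

theorem polyToLaurent_injective (K : Type*) [Field K] (m : ℕ) :
    Function.Injective (polyToLaurent K m) := by
  intro p q h
  ext s
  rw [← coeff_polyToLaurent, ← coeff_polyToLaurent, h]

/-- The field of rational functions `K(z_1, …, z_m)`. -/
abbrev RationalFunction (K : Type*) [Field K] (m : ℕ) : Type _ :=
  FractionRing (MvPolynomial (Fin m) K)

/-- The embedding of the field of rational functions into the field of iterated Laurent series. -/
noncomputable def RationalFunction.expand {K : Type*} [Field K] {m : ℕ} :
    RationalFunction K m →ₐ[K] IteratedLaurent K m :=
  IsFractionRing.liftAlgHom (g := polyToLaurent K m) (polyToLaurent_injective K m)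

end BinomialSums

/-! From a binomial sum to a rational function. Let `constantTerms` be the span of the sequences
$n\mapsto[z^0]\,S\,R_1^{n_1}\cdots R_e^{n_e}$, with $S$ and the $R_i \ne 0$ rational in $z$; the
power product is encoded as a character of $\mathbb Z^{\mathbb N}$. This span has all the closure
properties of binomial sums (`isBinomialClosed_constantTerms`): $\delta_n=[z^0]z^n$ and $\binom
nk=[z^0](1+z)^nz^{-k}$; a product is obtained by giving the two factors disjoint sets of variables;
an affine substitution only changes $S$ and the $R_i$; and a directed sum is a geometric sum, whose
closed form holds for every integer bound. Moreover $\sum_{n\in\mathbb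
N^d}t^n[z^0]SR^n=[z^0]\,S\prod_i(1-t_iR_i)^{-1}$, and the expansion on the right is the geometric
series in the $t_i$ because each $t_i$ is infinitesimal with respect to all Laurent series in $z$
(`exists_slice_eq_geometric`).

From a rational function to a binomial sum. All the coefficients of $p/q$ form a binomial sum on
$\mathbb Z^{d+r}$ (`isBinomialSum_coeffAt_expand`), and setting the exponents of $z$ to $0$ is an
affine substitution. Dividing $q$ by its leading term reduces the inverse of $q$ to
$(1-P)^{-1}=\sum_kP^k$, where $P$ has finitely many exponents, all positive. A linear form $w$ that
is at least $1$ on these exponents (`exists_weight`) bounds the sum: only $k\le w(n)$ contributes to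
the coefficient at $n$. The coefficients of $P^k$ form a binomial sum in the exponent and $k$
jointly, by the binomial theorem applied to one monomial of $P$ at a time. -/

namespace BinomialSums

/-! ### Changes of variables and slices of iterated Laurent series -/

section Slices

variable {K : Type*} [Field K] {r m : ℕ}

/-- The extension of exponents by zero along an order embedding of the sets of variables. -/
noncomputable def extendExponent (σ : Fin r ↪o Fin m) :
    Lex (Fin r → ℤ) →+ Lex (Fin m → ℤ) where
  toFun n := toLex (Function.extend σ (ofLex n) 0)
  map_zero' := by
    exact congrArg toLex (Function.extend_zero σ)
  map_add' a b := by
    rw [← toLex_add, toLex_inj, ofLex_add, ← Function.extend_add, add_zero]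

theorem extendExponent_apply (σ : Fin r ↪o Fin m) (n : Lex (Fin r → ℤ)) (i : Fin r) :
    ofLex (extendExponent σ n) (σ i) = ofLex n i :=
  σ.injective.extend_apply _ _ _

theorem extendExponent_apply_of_notMem (σ : Fin r ↪o Fin m) (n : Lex (Fin r → ℤ)) {j : Fin m}
    (hj : ¬∃ i, σ i = j) : ofLex (extendExponent σ n) j = 0 :=
  Function.extend_apply' _ _ _ hj

theorem extendExponent_strictMono (σ : Fin r ↪o Fin m) : StrictMono (extendExponent σ) := by
  rintro a b ⟨i, hi, hlt⟩
  refine ⟨σ i, fun j hj => ?_, ?_⟩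
  · by_cases h : ∃ k, σ k = j
    · obtain ⟨k, rfl⟩ := h
      rw [σ.lt_iff_lt] at hj
      exact (extendExponent_apply σ a k).trans
        ((hi k hj).trans (extendExponent_apply σ b k).symm)
    · exact (extendExponent_apply_of_notMem σ a h).trans
        (extendExponent_apply_of_notMem σ b h).symm
  · exact (extendExponent_apply σ a i).trans_lt (hlt.trans_eq (extendExponent_apply σ b i).symm)

theorem extendExponent_single (σ : Fin r ↪o Fin m) (i : Fin r) :
    extendExponent σ (toLex (Pi.single i 1)) = toLex (Pi.single (σ i) 1) := by
  rw [← ofLex_inj]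
  funext j
  by_cases h : ∃ k, σ k = j
  · obtain ⟨k, rfl⟩ := h
    rw [extendExponent_apply]
    simp [Pi.single_apply]
  · rw [extendExponent_apply_of_notMem _ _ h, ofLex_toLex,
      Pi.single_eq_of_ne (fun hj => h ⟨i, hj.symm⟩)]

/-- The embedding of the fields of iterated Laurent series that sends the variable `z_i` to
`z_{σ i}`. -/
noncomputable def extendVars (K : Type*) [Field K] (σ : Fin r ↪o Fin m) :
    IteratedLaurent K r →ₐ[K] IteratedLaurent K m :=
  HahnSeries.embDomainAlgHom (extendExponent σ) (extendExponent_strictMono σ).injective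
    fun _ _ => (extendExponent_strictMono σ).le_iff_le

theorem coeff_extendVars (σ : Fin r ↪o Fin m) (f : IteratedLaurent K r) (n : Lex (Fin r → ℤ)) :
    (extendVars K σ f).coeff (extendExponent σ n) = f.coeff n :=
  HahnSeries.embDomain_mk_coeff (extendExponent_strictMono σ).injective
    fun _ _ => (extendExponent_strictMono σ).le_iff_le

theorem coeff_extendVars_of_notMem (σ : Fin r ↪o Fin m) (f : IteratedLaurent K r)
    {n : Lex (Fin m → ℤ)} (hn : n ∉ Set.range (extendExponent σ)) :
    (extendVars K σ f).coeff n = 0 :=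
  HahnSeries.embDomain_of_notMem_range hn

theorem extendVars_var (σ : Fin r ↪o Fin m) (i : Fin r) :
    extendVars K σ (IteratedLaurent.var K i) = IteratedLaurent.var K (σ i) := by
  unfold IteratedLaurent.var
  rw [← extendExponent_single]
  exact HahnSeries.embDomain_single

/-- The field of the expansions of rational functions. -/
noncomputable def rational (K : Type*) [Field K] (m : ℕ) :
    IntermediateField K (IteratedLaurent K m) :=
  (RationalFunction.expand (K := K) (m := m)).fieldRange

theorem mem_rational {f : IteratedLaurent K m} :
    f ∈ rational K m ↔ ∃ R : RationalFunction K m, RationalFunction.expand R = f :=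
  AlgHom.mem_fieldRange

theorem expand_algebraMap (p : MvPolynomial (Fin m) K) :
    RationalFunction.expand (algebraMap _ (RationalFunction K m) p) = polyToLaurent K m p :=
  IsFractionRing.lift_algebraMap (g := (polyToLaurent K m).toRingHom)
    (polyToLaurent_injective K m) p

theorem polyToLaurent_mem_rational (p : MvPolynomial (Fin m) K) :
    polyToLaurent K m p ∈ rational K m :=
  mem_rational.2 ⟨_, expand_algebraMap p⟩

theorem exists_expand_eq_div (R : RationalFunction K m) :
    ∃ p q : MvPolynomial (Fin m) K, q ≠ 0 ∧
      RationalFunction.expand R = polyToLaurent K m p / polyToLaurent K m q := by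
  obtain ⟨p, q, hq, rfl⟩ := IsFractionRing.div_surjective (A := MvPolynomial (Fin m) K) R
  exact ⟨p, q, nonZeroDivisors.ne_zero hq, by rw [map_div₀, expand_algebraMap, expand_algebraMap]⟩

theorem var_mem_rational (i : Fin m) : IteratedLaurent.var K i ∈ rational K m := by
  have h := polyToLaurent_mem_rational (K := K) (MvPolynomial.X i)
  rwa [polyToLaurent, MvPolynomial.aeval_X] at h

theorem extendVars_polyToLaurent (σ : Fin r ↪o Fin m) (p : MvPolynomial (Fin r) K) :
    extendVars K σ (polyToLaurent K r p) = polyToLaurent K m (MvPolynomial.rename σ p) := by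
  have h : (extendVars K σ).comp (polyToLaurent K r) =
      (polyToLaurent K m).comp (MvPolynomial.rename σ) := by
    ext i : 1
    simp [polyToLaurent, extendVars_var]
  exact DFunLike.congr_fun h p

theorem extendVars_mem_rational (σ : Fin r ↪o Fin m) {f : IteratedLaurent K r}
    (hf : f ∈ rational K r) : extendVars K σ f ∈ rational K m := by
  obtain ⟨R, rfl⟩ := mem_rational.1 hf
  obtain ⟨p, q, -, h⟩ := exists_expand_eq_div R
  rw [h, map_div₀, extendVars_polyToLaurent, extendVars_polyToLaurent]
  exact div_mem (polyToLaurent_mem_rational _) (polyToLaurent_mem_rational _)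

/-- The coefficient of the monomial of exponent `a` in an iterated Laurent series, as a series in
the variables in the range of `σ`. -/
noncomputable def slice (σ : Fin r ↪o Fin m) (a : Lex (Fin m → ℤ)) (F : IteratedLaurent K m) :
    IteratedLaurent K r where
  coeff n := F.coeff (a + extendExponent σ n)
  isPWO_support' := by
    intro f
    obtain ⟨i, j, hij, h⟩ := F.isPWO_support fun k => ⟨a + extendExponent σ (f k), (f k).2⟩
    exact ⟨i, j, hij, (extendExponent_strictMono σ).le_iff_le.1 (le_of_add_le_add_left h)⟩

theorem coeff_slice (σ : Fin r ↪o Fin m) (a : Lex (Fin m → ℤ)) (F : IteratedLaurent K m)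
    (n : Lex (Fin r → ℤ)) : (slice σ a F).coeff n = F.coeff (a + extendExponent σ n) :=
  rfl

theorem slice_sub (σ : Fin r ↪o Fin m) (a : Lex (Fin m → ℤ)) (F G : IteratedLaurent K m) :
    slice σ a (F - G) = slice σ a F - slice σ a G := by
  ext n
  simp [coeff_slice]

theorem slice_single_mul (σ : Fin r ↪o Fin m) (a b : Lex (Fin m → ℤ)) (F : IteratedLaurent K m) :
    slice σ a (HahnSeries.single b 1 * F) = slice σ (a - b) F := by
  ext n
  rw [coeff_slice, coeff_slice, HahnSeries.coeff_single_mul, one_mul, sub_add_eq_add_sub]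

/-- Multiplying by a series in the variables of `σ` only moves exponents inside the range of
`extendExponent σ`, so both Cauchy products run over the same pairs. Hence slicing is linear over
these series. -/
theorem slice_extendVars_mul (σ : Fin r ↪o Fin m) (a : Lex (Fin m → ℤ)) (f : IteratedLaurent K r)
    (F : IteratedLaurent K m) : slice σ a (extendVars K σ f * F) = f * slice σ a F := by
  ext n
  rw [coeff_slice, HahnSeries.coeff_mul, HahnSeries.coeff_mul]
  symm
  refine Finset.sum_bij (fun p _ => (extendExponent σ p.1, a + extendExponent σ p.2)) ?_ ?_ ?_ ?_
  · rintro ⟨p, q⟩ h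
    rw [Finset.mem_antidiagonal] at h ⊢
    refine ⟨?_, h.2.1, ?_⟩
    · rw [HahnSeries.mem_support, coeff_extendVars]
      exact h.1
    · rw [← h.2.2, map_add, add_left_comm]
  · rintro ⟨p, q⟩ - ⟨p', q'⟩ - h
    rw [Prod.mk.injEq, add_right_inj] at h
    exact Prod.ext ((extendExponent_strictMono σ).injective h.1)
      ((extendExponent_strictMono σ).injective h.2)
  · rintro ⟨p, q⟩ h
    rw [Finset.mem_antidiagonal] at h
    obtain ⟨hp, hq, h⟩ := h
    by_cases hr : p ∈ Set.range (extendExponent σ)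
    · obtain ⟨p, rfl⟩ := hr
      have hq' : q = a + extendExponent σ (n - p) := by
        rw [map_sub, ← add_sub_assoc, ← h]
        simp
      refine ⟨(p, n - p), ?_, by rw [hq']⟩
      rw [Finset.mem_antidiagonal]
      refine ⟨?_, ?_, by simp⟩
      · rw [HahnSeries.mem_support, coeff_extendVars] at hp
        exact hp
      · rw [hq'] at hq
        exact hq
    · exact absurd (coeff_extendVars_of_notMem σ f hr) hp
  · rintro ⟨p, q⟩ -
    rw [coeff_extendVars, coeff_slice]

/-- Since `b` exceeds every exponent in the variables of `σ`, increasing `k` strictly lowers all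
exponents of the slice. The support is well-ordered, so past the `k₀` of its least exponent of this
form nothing remains. -/
theorem exists_slice_eq_zero (σ : Fin r ↪o Fin m) (a : Lex (Fin m → ℤ)) {b : Lex (Fin m → ℤ)}
    (hb : ∀ n, extendExponent σ n < b) (F : IteratedLaurent K m) :
    ∃ k₀ : ℕ, ∀ k ≥ k₀, slice σ (a - k • b) F = 0 := by
  have hwf : {x | x ∈ F.support ∧ ∃ (k : ℕ) (n : _), x = a - k • b + extendExponent σ n}.IsWF :=
    F.isWF_support.mono fun x hx => hx.1
  by_cases h : {x | x ∈ F.support ∧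
      ∃ (k : ℕ) (n : _), x = a - k • b + extendExponent σ n}.Nonempty
  · obtain ⟨-, k₀, n₀, hmin⟩ := hwf.min_mem h
    refine ⟨k₀ + 1, fun k hk => ?_⟩
    ext n
    by_contra hne
    refine hwf.not_lt_min h ⟨hne, k, n, rfl⟩ ?_
    rw [hmin]
    obtain ⟨j, rfl⟩ := Nat.exists_eq_add_of_le hk
    have hb0 : 0 ≤ b := (map_zero (extendExponent σ)).symm.trans_lt (hb 0) |>.le
    have h₁ := hb (n - n₀)
    rw [map_sub, sub_lt_iff_lt_add] at h₁
    calc a - (k₀ + 1 + j) • b + extendExponent σ n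
        < a - (k₀ + 1 + j) • b + (b + extendExponent σ n₀) := by gcongr
      _ = a - k₀ • b + extendExponent σ n₀ - j • b := by
        rw [add_smul, add_smul, one_smul]
        abel
      _ ≤ _ := sub_le_self _ (nsmul_nonneg hb0 j)
  · refine ⟨0, fun k _ => ?_⟩
    ext n
    by_contra hne
    exact h ⟨_, hne, k, n, rfl⟩

/-- As the variables are disjoint, the second factor seen as a series in the variables of `σ` has
only its constant term. This is what turns products of constant terms into constant terms. -/
theorem coeff_zero_extendVars_mul {r₁ r₂ : ℕ} (σ : Fin r₁ ↪o Fin m) (τ : Fin r₂ ↪o Fin m)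
    (h : ∀ i j, σ i ≠ τ j) (f : IteratedLaurent K r₁) (g : IteratedLaurent K r₂) :
    (extendVars K σ f * extendVars K τ g).coeff 0 = f.coeff 0 * g.coeff 0 := by
  have hs : slice σ 0 (extendVars K τ g) = HahnSeries.single 0 (g.coeff 0) := by
    ext n
    rw [coeff_slice, zero_add, HahnSeries.coeff_single]
    split_ifs with hn
    · rw [hn, map_zero, ← map_zero (extendExponent τ), coeff_extendVars]
    · refine coeff_extendVars_of_notMem _ _ ?_
      rintro ⟨k, hk⟩
      refine hn (ofLex_inj.1 (funext fun i => ?_))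
      rw [← extendExponent_apply σ, ← hk, extendExponent_apply_of_notMem]
      · rfl
      · rintro ⟨j, hj⟩
        exact h i j hj.symm
  have h0 := coeff_slice σ 0 (extendVars K σ f * extendVars K τ g) 0
  rw [map_zero, add_zero] at h0
  rw [← h0, slice_extendVars_mul, hs, HahnSeries.coeff_mul_single_zero]

end Slices

/-! ### Directed sums -/

section DirectedSum

variable {M : Type*} [AddCommGroup M]

theorem directedSum_add (a b : ℤ) (f g : ℤ → M) :
    directedSum a b (fun k => f k + g k) = directedSum a b f + directedSum a b g := by
  unfold directedSum
  split_ifs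
  · exact Finset.sum_add_distrib
  · rw [Finset.sum_add_distrib, neg_add]

theorem directedSum_smul {R : Type*} [Ring R] [Module R M] (a b : ℤ) (c : R) (f : ℤ → M) :
    directedSum a b (fun k => c • f k) = c • directedSum a b f := by
  unfold directedSum
  split_ifs
  · exact Finset.smul_sum.symm
  · rw [← Finset.smul_sum, smul_neg]

theorem directedSum_zero_neg_one (f : ℤ → M) : directedSum 0 (-1) f = 0 := by
  simp [directedSum]

theorem directedSum_zero_add_one (m : ℤ) (f : ℤ → M) :
    directedSum 0 (m + 1) f = directedSum 0 m f + f (m + 1) := by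
  unfold directedSum
  rcases lt_trichotomy m (-1) with h | rfl | h
  · rw [if_neg (by lia), if_neg (by lia), zero_sub,
      show Finset.Icc (m + 1) (-1) = insert (m + 1) (Finset.Icc (m + 1 + 1) (-1)) by
        ext; simp; lia, 
      Finset.sum_insert (by simp)]
    abel
  · simp
  · rw [if_pos (by lia), if_pos (by lia),
      show Finset.Icc 0 (m + 1) = insert (m + 1) (Finset.Icc 0 m) by ext; simp; lia,
      Finset.sum_insert (by simp), add_comm]

/-- The directed sum satisfies the same recurrence and vanishes at `-1`, where the sum is empty; the
recurrence propagates in both directions. Closed forms thus hold for negative upper bounds too. -/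
theorem directedSum_eq_of_forall_add_one {f g : ℤ → M} (h0 : g (-1) = 0)
    (h : ∀ m, g (m + 1) = g m + f (m + 1)) (m : ℤ) : directedSum 0 m f = g m := by
  induction m using Int.inductionOn' (b := -1) with
  | zero => rw [directedSum_zero_neg_one, h0]
  | succ k _ ih => rw [directedSum_zero_add_one, h, ih]
  | pred k _ ih =>
    have h₁ := directedSum_zero_add_one (k - 1) f
    have h₂ := h (k - 1)
    rw [sub_add_cancel] at h₁ h₂
    rw [h₁, h₂] at ih
    exact add_right_cancel ih

theorem directedSum_zero_const (m : ℤ) (c : M) :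
    directedSum 0 m (fun _ => c) = (m + 1) • c :=
  directedSum_eq_of_forall_add_one (g := fun m => (m + 1) • c) (by simp)
    (fun m => by rw [add_smul (m + 1), one_smul]) m

end DirectedSum

/-! ### Truncation of indices -/

/-- The extension by zero of the points of `ℤ^d`, as a morphism of groups. -/
def extendIndexHom (d : ℕ) : (Fin d → ℤ) →+ (ℕ → ℤ) where
  toFun := extendIndex
  map_zero' := by
    ext i
    simp [extendIndex]
  map_add' a b := by
    ext i
    by_cases h : i < d <;> simp [extendIndex, h]

theorem extendIndex_add {d : ℕ} (a b : Fin d → ℤ) :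
    extendIndex (a + b) = extendIndex a + extendIndex b :=
  (extendIndexHom d).map_add a b

/-- The first coordinates of a point of `ℤ^ℕ`, as a morphism of groups. -/
def restrictIndexHom (d : ℕ) : (ℕ → ℤ) →+ (Fin d → ℤ) where
  toFun := restrictIndex d
  map_zero' := rfl
  map_add' _ _ := rfl

@[simp]
theorem restrictIndex_extendIndex {d : ℕ} (n : Fin d → ℤ) :
    restrictIndex d (extendIndex n) = n := by
  ext i
  simp [restrictIndex, extendIndex]

/-- The map that replaces by zero all the coordinates but the first `d` ones. -/
def truncate (d : ℕ) (x : ℕ → ℤ) : ℕ → ℤ := extendIndex (restrictIndex d x)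

theorem truncate_apply (d : ℕ) (x : ℕ → ℤ) (i : ℕ) :
    truncate d x i = if i < d then x i else 0 := by
  simp [truncate, extendIndex, restrictIndex]

theorem restrictIndex_truncate (d : ℕ) (x : ℕ → ℤ) :
    restrictIndex d (truncate d x) = restrictIndex d x :=
  restrictIndex_extendIndex _

theorem truncate_truncate_of_le {d e : ℕ} (h : d ≤ e) (x : ℕ → ℤ) :
    truncate d (truncate e x) = truncate d x := by
  ext i
  simp only [truncate_apply]
  split_ifs <;> first | rfl | lia

/-- Varying the last index is moving along a basis vector, so a character becomes geometric in the
summation index. -/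
theorem extendIndex_snoc_init (d : ℕ) (x : ℕ → ℤ) (k : ℤ) :
    extendIndex (Fin.snoc (α := fun _ => ℤ) (Fin.init (restrictIndex (d + 1) x)) k) =
      truncate d x + k • Pi.single d 1 := by
  ext i
  rw [Pi.add_apply, truncate_apply, extendIndex]
  rcases lt_trichotomy i d with h | rfl | h
  · rw [dif_pos (by lia), if_pos h, Fin.snoc, dif_pos h]
    simp [Fin.init, restrictIndex, h.ne]
  · simp [Fin.snoc]
  · simp [h.ne', h.not_gt, show ¬ i < d + 1 by lia]

theorem truncate_add_one (d : ℕ) (x : ℕ → ℤ) :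
    truncate (d + 1) x = truncate d x + x d • Pi.single d 1 := by
  rw [← extendIndex_snoc_init, truncate]
  congr 1
  exact (Fin.snoc_init_self (restrictIndex (d + 1) x)).symm

/-! ### Powers of the series `1 + z` -/

section Binomial

variable {K : Type*} [Field K]

theorem single_one_zpow {m : ℕ} (g : Lex (Fin m → ℤ)) (n : ℤ) :
    (HahnSeries.single g 1 : IteratedLaurent K m) ^ n = HahnSeries.single (n • g) 1 := by
  cases n with
  | ofNat n => simp [HahnSeries.single_pow]
  | negSucc n =>
    rw [zpow_negSucc, HahnSeries.single_pow, HahnSeries.inv_single, negSucc_zsmul]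
    simp

theorem var_zpow (n : ℤ) :
    IteratedLaurent.var K (0 : Fin 1) ^ n = HahnSeries.single (toLex fun _ => n) 1 := by
  have h : (n • Pi.single 0 1 : Fin 1 → ℤ) = fun _ => n := by
    ext j
    rw [Subsingleton.elim j 0]
    simp
  rw [IteratedLaurent.var, single_one_zpow, ← h]
  rfl

theorem var_ne_zero {m : ℕ} (i : Fin m) : IteratedLaurent.var K i ≠ 0 :=
  HahnSeries.single_ne_zero one_ne_zero

/-- The exponents of the powers of the variable, in one variable. -/
def natExponent : ℕ →+ Lex (Fin 1 → ℤ) where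
  toFun k := toLex fun _ => (k : ℤ)
  map_zero' := rfl
  map_add' a b := by
    rw [← toLex_add, toLex_inj]
    ext
    simp

theorem natExponent_strictMono : StrictMono natExponent := fun a b h =>
  ⟨0, fun j hj => absurd hj (Fin.not_lt_zero j), show (a : ℤ) < b by exact_mod_cast h⟩

/-- The power series in one variable, as iterated Laurent series. -/
noncomputable def powerSeriesToLaurent (K : Type*) [Field K] :
    PowerSeries K →+* IteratedLaurent K 1 :=
  (HahnSeries.embDomainRingHom natExponent natExponent_strictMono.injective
    fun _ _ => natExponent_strictMono.le_iff_le).comp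
  (HahnSeries.toPowerSeries (R := K)).symm.toRingHom

theorem coeff_powerSeriesToLaurent (p : PowerSeries K) (k : ℕ) :
    (powerSeriesToLaurent K p).coeff (toLex fun _ => (k : ℤ)) = PowerSeries.coeff k p :=
  HahnSeries.embDomain_mk_coeff (f := natExponent) (x := HahnSeries.toPowerSeries.symm p)
    natExponent_strictMono.injective fun _ _ => natExponent_strictMono.le_iff_le

theorem coeff_powerSeriesToLaurent_of_neg (p : PowerSeries K) {k : ℤ} (hk : k < 0) :
    (powerSeriesToLaurent K p).coeff (toLex fun _ => k) = 0 := by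
  refine HahnSeries.embDomain_of_notMem_range (x := HahnSeries.toPowerSeries.symm p)
    (f := ⟨⟨natExponent, natExponent_strictMono.injective⟩, natExponent_strictMono.le_iff_le⟩) ?_
  rintro ⟨j, hj⟩
  have h : (j : ℤ) = k := congrFun (toLex_inj.1 hj) 0
  lia

theorem powerSeriesToLaurent_X :
    powerSeriesToLaurent K PowerSeries.X = IteratedLaurent.var K 0 := by
  ext g
  obtain ⟨k, rfl⟩ : ∃ k, g = toLex fun _ => k := ⟨ofLex g 0, by
    rw [← ofLex_inj]; ext i; rw [Subsingleton.elim i 0]; rfl⟩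
  have hk : (toLex fun _ => k : Lex (Fin 1 → ℤ)) = toLex (Pi.single 0 1) ↔ k = 1 := by
    rw [toLex_inj, funext_iff]
    simp
  rw [IteratedLaurent.var, HahnSeries.coeff_single]
  simp only [hk]
  rcases lt_or_ge k 0 with h | h
  · rw [coeff_powerSeriesToLaurent_of_neg _ h, if_neg (by lia)]
  · lift k to ℕ using h
    rw [coeff_powerSeriesToLaurent, PowerSeries.coeff_X]
    norm_cast

theorem powerSeriesToLaurent_binomialSeries (n : ℤ) :
    powerSeriesToLaurent K (PowerSeries.binomialSeries K n) =
      (1 + IteratedLaurent.var K 0) ^ n := by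
  have hnat (n : ℕ) : powerSeriesToLaurent K (PowerSeries.binomialSeries K (n : ℤ)) =
      (1 + IteratedLaurent.var K 0) ^ n := by
    rw [PowerSeries.binomialSeries_nat, map_pow, map_add, map_one, powerSeriesToLaurent_X]
  cases n with
  | ofNat n => exact (hnat n).trans (zpow_natCast _ n).symm
  | negSucc n =>
    rw [zpow_negSucc]
    -- The binomial series of opposite exponents are inverse to each other.
    refine eq_inv_of_mul_eq_one_left ?_
    rw [← hnat, ← map_mul, ← PowerSeries.binomialSeries_add, Int.negSucc_eq, ← Nat.cast_add_one,
      neg_add_cancel, PowerSeries.binomialSeries_zero, map_one]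

theorem one_add_var_ne_zero : 1 + IteratedLaurent.var K (0 : Fin 1) ≠ 0 := by
  intro h
  have h₁ := powerSeriesToLaurent_binomialSeries (K := K) 1
  have h₂ := coeff_powerSeriesToLaurent (PowerSeries.binomialSeries K (1 : ℤ)) 0
  rw [h₁, zpow_one, h, PowerSeries.binomialSeries_coeff] at h₂
  simp at h₂

theorem coeff_one_add_var_zpow (n k : ℤ) :
    ((1 + IteratedLaurent.var K (0 : Fin 1)) ^ n).coeff (toLex fun _ => k) =
      (intChoose n k : ℤ) := by
  rw [← powerSeriesToLaurent_binomialSeries, intChoose]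
  split_ifs with h
  · lift k to ℕ using h
    rw [coeff_powerSeriesToLaurent, PowerSeries.binomialSeries_coeff]
    simp
  · rw [coeff_powerSeriesToLaurent_of_neg _ (by lia), Int.cast_zero]

end Binomial

/-! ### Constant terms of geometric sequences of rational functions -/

section Geometric

variable {K : Type*} [Field K] {r : ℕ}

/-- A morphism from the group `ℤ^ℕ` to the multiplicative group of rational functions is a rational
character if it depends only on finitely many coordinates. -/
structure IsRationalCharacter (χ : Multiplicative (ℕ → ℤ) →* IteratedLaurent K r) : Prop where
  mem : ∀ x, χ x ∈ rational K r
  finite : ∃ d, ∀ x, χ (.ofAdd (truncate d x)) = χ (.ofAdd x)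

/-- The character `x ↦ f ^ (x i)`. -/
noncomputable def powCharacter (f : IteratedLaurent K r) (hf : f ≠ 0) (i : ℕ) :
    Multiplicative (ℕ → ℤ) →* IteratedLaurent K r where
  toFun x := f ^ x.toAdd i
  map_one' := zpow_zero f
  map_mul' _ _ := zpow_add₀ hf _ _

theorem isRationalCharacter_powCharacter {f : IteratedLaurent K r} (hf : f ≠ 0)
    (h : f ∈ rational K r) (i : ℕ) : IsRationalCharacter (powCharacter f hf i) where
  mem _ := zpow_mem h _
  finite := ⟨i + 1, fun x => by simp [powCharacter, truncate_apply]⟩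

theorem IsRationalCharacter.one :
    IsRationalCharacter (1 : Multiplicative (ℕ → ℤ) →* IteratedLaurent K r) where
  mem _ := one_mem _
  finite := ⟨0, fun _ => rfl⟩

theorem IsRationalCharacter.mul {χ ψ : Multiplicative (ℕ → ℤ) →* IteratedLaurent K r}
    (hχ : IsRationalCharacter χ) (hψ : IsRationalCharacter ψ) : IsRationalCharacter (χ * ψ) where
  mem x := mul_mem (hχ.mem x) (hψ.mem x)
  finite := by
    obtain ⟨d, hd⟩ := hχ.finite
    obtain ⟨e, he⟩ := hψ.finite
    refine ⟨max d e, fun x => ?_⟩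
    rw [MonoidHom.mul_apply, MonoidHom.mul_apply, ← hd, ← he,
      truncate_truncate_of_le (le_max_left d e), truncate_truncate_of_le (le_max_right d e), hd, he]

theorem IsRationalCharacter.comp {χ : Multiplicative (ℕ → ℤ) →* IteratedLaurent K r}
    (hχ : IsRationalCharacter χ) {d : ℕ} (f : (Fin d → ℤ) →+ (ℕ → ℤ)) :
    IsRationalCharacter (χ.comp (f.comp (restrictIndexHom d)).toMultiplicative) where
  mem _ := hχ.mem _
  finite := ⟨d, fun x => congrArg (fun n => χ (.ofAdd (f n))) (restrictIndex_truncate d x)⟩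

theorem IsRationalCharacter.extendVars {m : ℕ}
    {χ : Multiplicative (ℕ → ℤ) →* IteratedLaurent K r}
    (hχ : IsRationalCharacter χ) (σ : Fin r ↪o Fin m) :
    IsRationalCharacter ((extendVars K σ : IteratedLaurent K r →* IteratedLaurent K m).comp χ) where
  mem x := extendVars_mem_rational σ (hχ.mem x)
  finite := hχ.finite.imp fun _ h x => congrArg (BinomialSums.extendVars K σ) (h x)

theorem character_ne_zero (χ : Multiplicative (ℕ → ℤ) →* IteratedLaurent K r)
    (x : Multiplicative (ℕ → ℤ)) : χ x ≠ 0 := by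
  have h : χ x * χ x⁻¹ = 1 := by rw [← map_mul, mul_inv_cancel, map_one]
  exact left_ne_zero_of_mul_eq_one h

theorem character_zsmul (χ : Multiplicative (ℕ → ℤ) →* IteratedLaurent K r)
    (x : ℕ → ℤ) (k : ℤ) : χ (.ofAdd (k • x)) = χ (.ofAdd x) ^ k := by
  rw [ofAdd_zsmul]
  exact map_zpow' χ (fun y => eq_inv_of_mul_eq_one_left
    (by rw [← map_mul, inv_mul_cancel, map_one])) _ _

/-- The sequences `x ↦ [z^0] S R^x`, for rational functions `S` and `R_i` in `z_1, …, z_r`. -/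
def IsGeometric (u : (ℕ → ℤ) → K) : Prop :=
  ∃ (r : ℕ) (S : IteratedLaurent K r) (χ : Multiplicative (ℕ → ℤ) →* IteratedLaurent K r),
    S ∈ rational K r ∧ IsRationalCharacter χ ∧ ∀ x, u x = (S * χ (.ofAdd x)).coeff 0

theorem IsGeometric.one : IsGeometric (1 : (ℕ → ℤ) → K) :=
  ⟨0, 1, 1, one_mem _, .one, fun x => by simp⟩

/-- The factors are given disjoint blocks of the `r + s` variables, where constant terms multiply.
-/
theorem IsGeometric.mul {u v : (ℕ → ℤ) → K} (hu : IsGeometric u) (hv : IsGeometric v) :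
    IsGeometric (u * v) := by
  obtain ⟨r, S, χ, hS, hχ, hu⟩ := hu
  obtain ⟨s, T, ψ, hT, hψ, hv⟩ := hv
  refine ⟨r + s, extendVars K (Fin.castAddOrderEmb s) S * extendVars K (Fin.natAddOrderEmb r) T,
    _, mul_mem (extendVars_mem_rational _ hS) (extendVars_mem_rational _ hT),
    (hχ.extendVars (Fin.castAddOrderEmb s)).mul (hψ.extendVars (Fin.natAddOrderEmb r)),
    fun x => ?_⟩
  rw [Pi.mul_apply, hu, hv, ← coeff_zero_extendVars_mul (Fin.castAddOrderEmb s)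
    (Fin.natAddOrderEmb r) (fun i j h => ?_), map_mul, map_mul, mul_mul_mul_comm]
  · rfl
  · have := congrArg Fin.val h
    simp at this
    lia

theorem IsGeometric.exists_eq_truncate {u : (ℕ → ℤ) → K} (hu : IsGeometric u) :
    ∃ d, ∀ x, u (truncate d x) = u x := by
  obtain ⟨r, S, χ, hS, hχ, hu⟩ := hu
  obtain ⟨d, hd⟩ := hχ.finite
  exact ⟨d, fun x => by rw [hu, hu, hd]⟩

/-- The algebra of the linear combinations of constant terms of geometric sequences. -/
def constantTerms (K : Type*) [Field K] : Subalgebra K ((ℕ → ℤ) → K) :=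
  (Submodule.span K {u | IsGeometric u}).toSubalgebra (Submodule.subset_span IsGeometric.one)
    fun u v hu hv => by
      induction hu, hv using Submodule.span_induction₂ with
      | mem_mem u v hu hv => exact Submodule.subset_span (hu.mul hv)
      | zero_left v _ => simp
      | zero_right u _ => simp
      | add_left u v w _ _ _ hu hv => rw [add_mul]; exact add_mem hu hv
      | add_right u v w _ _ _ hu hv => rw [mul_add]; exact add_mem hu hv
      | smul_left c u v _ _ h => rw [smul_mul_assoc]; exact Submodule.smul_mem _ _ h
      | smul_right c u v _ _ h => rw [mul_smul_comm]; exact Submodule.smul_mem _ _ h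

theorem IsGeometric.mem_constantTerms {u : (ℕ → ℤ) → K} (hu : IsGeometric u) :
    u ∈ constantTerms K :=
  Submodule.subset_span hu

theorem constantTerms_induction {p : (u : (ℕ → ℤ) → K) → u ∈ constantTerms K → Prop}
    (geometric : ∀ u (hu : IsGeometric u), p u hu.mem_constantTerms)
    (zero : p 0 (zero_mem _))
    (add : ∀ u v hu hv, p u hu → p v hv → p (u + v) (add_mem hu hv))
    (smul : ∀ (c : K) u hu, p u hu → p (c • u) (Subalgebra.smul_mem _ hu c))
    {u : (ℕ → ℤ) → K} (hu : u ∈ constantTerms K) : p u hu :=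
  Submodule.span_induction (p := p) geometric zero add smul hu

theorem constantTerms_le_sequences : constantTerms K ≤ sequences K := by
  intro u hu
  induction hu using constantTerms_induction with
  | geometric u hu =>
    obtain ⟨d, hd⟩ := hu.exists_eq_truncate
    exact ⟨d, restrictSeq d u, funext fun x => (hd x).symm⟩
  | zero => exact zero_mem _
  | add u v _ _ hu hv => exact add_mem hu hv
  | smul c u _ hu => exact Subalgebra.smul_mem _ hu c

theorem constantTerms_affine (d e : ℕ) (f : (Fin d → ℤ) →ᵃ[ℤ] (Fin e → ℤ)) {u : (ℕ → ℤ) → K}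
    (hu : u ∈ constantTerms K) :
    liftSeq (fun n : Fin d → ℤ => restrictSeq e u (f n)) ∈ constantTerms K := by
  induction hu using constantTerms_induction with
  | geometric u hu =>
    obtain ⟨r, S, χ, hS, hχ, hu⟩ := hu
    -- The constant part of the affine map goes into `S`, the linear part into the character.
    refine IsGeometric.mem_constantTerms ⟨r, S * χ (.ofAdd (extendIndex (f 0))), _,
      mul_mem hS (hχ.mem _), hχ.comp ((extendIndexHom e).comp f.linear.toAddMonoidHom),
      fun x => ?_⟩
    have hf := congrFun (AffineMap.decomp f) (restrictIndex d x)
    rw [Pi.add_apply] at hf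
    rw [liftSeq, restrictSeq, hu, hf, extendIndex_add, add_comm, ofAdd_add, map_mul, mul_assoc]
    rfl
  | zero => exact zero_mem _
  | add u v _ _ hu hv => exact add_mem hu hv
  | smul c u _ hu => exact Subalgebra.smul_mem _ hu c

/-- This is $n=\binom n1=[z^0]z^{-1}(1+z)^n$, needed for geometric sums of ratio $1$. -/
theorem coord_mem_constantTerms (i : ℕ) : (fun x => (x i : K)) ∈ constantTerms K := by
  refine IsGeometric.mem_constantTerms ⟨1, HahnSeries.single (toLex fun _ => -1) 1, _, ?_,
    isRationalCharacter_powCharacter one_add_var_ne_zero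
      (add_mem (one_mem _) (var_mem_rational 0)) i, fun x => ?_⟩
  · rw [← var_zpow]
    exact zpow_mem (var_mem_rational 0) _
  · rw [HahnSeries.coeff_single_mul, one_mul, zero_sub]
    refine Eq.trans ?_ (coeff_one_add_var_zpow (x i) 1).symm
    simp [intChoose]

theorem constantTerms_sum (d : ℕ) {u : (ℕ → ℤ) → K} (hu : u ∈ constantTerms K) :
    liftSeq (fun n : Fin (d + 1) → ℤ => directedSum 0 (n (Fin.last d)) fun k =>
      restrictSeq (d + 1) u (Fin.snoc (Fin.init n) k)) ∈ constantTerms K := by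
  induction hu using constantTerms_induction with
  | geometric u hu =>
    obtain ⟨r, S, χ, hS, hχ, hu⟩ := hu
    -- `Q` is the ratio of the geometric progression in the summation index.
    set Q := χ (.ofAdd (Pi.single d 1)) with hQ
    have hQ0 : Q ≠ 0 := character_ne_zero χ _
    have hQmem : Q ∈ rational K r := hχ.mem _
    have hu' : liftSeq (fun n : Fin (d + 1) → ℤ => directedSum 0 (n (Fin.last d)) fun k =>
        restrictSeq (d + 1) u (Fin.snoc (Fin.init n) k)) = fun x : ℕ → ℤ =>
          directedSum 0 (x d) fun k => (S * χ (.ofAdd (truncate d x)) * Q ^ k).coeff 0 := by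
      ext x
      refine congrArg (directedSum 0 (x d)) (funext fun k => ?_)
      rw [restrictSeq, extendIndex_snoc_init, hu, ofAdd_add, map_mul, character_zsmul, mul_assoc]
    rw [hu']
    -- For ratio $1$ the sum is `x d + 1` times a geometric sequence; otherwise it is the difference
    -- of the two terms of $(Q^{m+1}-1)/(Q-1)$, where $Q^{x_d}$ is absorbed by truncating at `d + 1`
    -- instead of `d`.
    by_cases hQ1 : Q = 1
    · simp only [hQ1, one_zpow, mul_one, directedSum_zero_const]
      have h : (fun x : ℕ → ℤ => (x d + 1) • (S * χ (.ofAdd (truncate d x))).coeff 0) =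
          ((fun x => (x d : K)) + 1) *
            fun x : ℕ → ℤ => (S * χ (.ofAdd (truncate d x))).coeff 0 := by
        ext x
        simp
      rw [h]
      exact mul_mem (add_mem (coord_mem_constantTerms d) (one_mem _)) (IsGeometric.mem_constantTerms
        ⟨r, S, _, hS, hχ.comp (extendIndexHom d), fun x => rfl⟩)
    · have hQ1' : Q - 1 ≠ 0 := sub_ne_zero.2 hQ1
      have h : (fun x : ℕ → ℤ =>
          directedSum 0 (x d) fun k => (S * χ (.ofAdd (truncate d x)) * Q ^ k).coeff 0) =
          (fun x : ℕ → ℤ => (S * Q / (Q - 1) * χ (.ofAdd (truncate (d + 1) x))).coeff 0) -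
            fun x : ℕ → ℤ => (S / (Q - 1) * χ (.ofAdd (truncate d x))).coeff 0 := by
        ext x
        rw [directedSum_eq_of_forall_add_one (g := fun m =>
          (S * χ (.ofAdd (truncate d x)) * ((Q ^ (m + 1) - 1) / (Q - 1))).coeff 0)]
        · rw [Pi.sub_apply, ← HahnSeries.coeff_sub, truncate_add_one, ofAdd_add, map_mul,
            character_zsmul, ← hQ, zpow_add_one₀ hQ0]
          congr 1
          field_simp
        · simp
        · intro m
          rw [← HahnSeries.coeff_add, zpow_add_one₀ hQ0 (m + 1)]
          congr 1
          field_simp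
          ring
      rw [h]
      have hd := sub_mem hQmem (one_mem _)
      exact sub_mem
        (IsGeometric.mem_constantTerms ⟨r, _, _, div_mem (mul_mem hS hQmem) hd,
          hχ.comp (extendIndexHom (d + 1)), fun x => rfl⟩)
        (IsGeometric.mem_constantTerms ⟨r, _, _, div_mem hS hd,
          hχ.comp (extendIndexHom d), fun x => rfl⟩)
  | zero =>
    convert zero_mem (constantTerms K) using 1
    ext x
    simp [liftSeq, restrictSeq, directedSum]
  | add u v _ _ hu hv =>
    convert add_mem hu hv using 1
    ext x
    exact directedSum_add _ _ _ _
  | smul c u _ hu =>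
    convert Subalgebra.smul_mem _ hu c using 1
    ext x
    exact directedSum_smul _ _ c fun k =>
      restrictSeq (d + 1) u (Fin.snoc (Fin.init (restrictIndex (d + 1) x)) k)

theorem isBinomialClosed_constantTerms : IsBinomialClosed (constantTerms K) where
  delta := by
    refine IsGeometric.mem_constantTerms ⟨1, 1, _, one_mem _,
      isRationalCharacter_powCharacter (var_ne_zero 0) (var_mem_rational 0) 0, fun x => ?_⟩
    -- $\delta_n=[z^0]z^n$.
    have h : (IteratedLaurent.var K (0 : Fin 1) ^ x 0).coeff 0 = if x 0 = 0 then 1 else 0 := by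
      have h0 : (0 : Lex (Fin 1 → ℤ)) = toLex (fun _ => x 0) ↔ x 0 = 0 := by
        rw [← toLex_zero, toLex_inj, funext_iff]
        simp [eq_comm]
      rw [var_zpow, HahnSeries.coeff_single]
      simp only [h0]
    rw [one_mul]
    exact h.symm
  geom C hC := by
    have hC' : (algebraMap K (IteratedLaurent K 0) C) ≠ 0 := by simpa using hC
    refine IsGeometric.mem_constantTerms ⟨0, 1, _, one_mem _,
      isRationalCharacter_powCharacter hC' (algebraMap_mem _ _) 0, fun x => ?_⟩
    rw [one_mul]
    have h : (algebraMap K (IteratedLaurent K 0) C ^ x 0).coeff 0 = C ^ x 0 := by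
      rw [← map_zpow₀, HahnSeries.algebraMap_apply, HahnSeries.C_apply,
        HahnSeries.coeff_single_same]
      rfl
    exact h.symm
  binom := by
    refine IsGeometric.mem_constantTerms ⟨1, 1, _, one_mem _,
      (isRationalCharacter_powCharacter one_add_var_ne_zero
        (add_mem (one_mem _) (var_mem_rational 0)) 0).mul
      (isRationalCharacter_powCharacter (inv_ne_zero (var_ne_zero 0))
        (inv_mem (var_mem_rational 0)) 1), fun x => ?_⟩
    have h : ((1 + IteratedLaurent.var K (0 : Fin 1)) ^ x 0 *
        (IteratedLaurent.var K 0)⁻¹ ^ x 1).coeff 0 =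
        ((intChoose (x 0) (x 1) : ℤ) : K) := by
      rw [inv_zpow', var_zpow, HahnSeries.coeff_mul_single, mul_one, ← coeff_one_add_var_zpow]
      refine congrArg (HahnSeries.coeff _) ?_
      rw [← toLex_zero, ← toLex_sub, toLex_inj]
      ext j
      simp
    rw [one_mul]
    exact h.symm
  affine d e f _ hu := constantTerms_affine d e f hu
  sum d _ hu := constantTerms_sum d hu

theorem binomialSums_le_constantTerms : binomialSums K ≤ constantTerms K :=
  (isLeast_binomialSums K).2 ⟨constantTerms_le_sequences, isBinomialClosed_constantTerms⟩

end Geometric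

/-! ### Generating functions of binomial sums -/

section GeneratingFunction

variable {K : Type*} [Field K] {r d m : ℕ}

theorem extendExponent_eq_of_forall (σ : Fin r ↪o Fin m) {a : Lex (Fin r → ℤ)}
    {b : Lex (Fin m → ℤ)} (h : ∀ i, ofLex b (σ i) = ofLex a i)
    (h0 : ∀ j, (¬∃ i, σ i = j) → ofLex b j = 0) : extendExponent σ a = b := by
  rw [← ofLex_inj]
  ext j
  by_cases hj : ∃ i, σ i = j
  · obtain ⟨i, rfl⟩ := hj
    rw [extendExponent_apply, h]
  · rw [extendExponent_apply_of_notMem _ _ hj, h0 j hj]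

theorem extendExponent_castAdd (n : Fin d → ℤ) :
    extendExponent (Fin.castAddOrderEmb r) (toLex n) = toLex (Fin.append n fun _ => 0) := by
  refine extendExponent_eq_of_forall _
    (fun i => show Fin.append n (fun _ => 0) (Fin.castAdd r i) = n i by simp) fun j hj => ?_
  induction j using Fin.addCases with
  | left i => exact absurd ⟨i, rfl⟩ hj
  | right i => simp

/-- Unused variables can be appended without changing the coefficients in question, so that
generating functions with different `r` can be added. -/
theorem extendExponent_castLE {s : ℕ} (h : d + r ≤ d + s) (n : Fin d → ℤ) :
    extendExponent (Fin.castLEOrderEmb h) (toLex (Fin.append n fun _ => 0)) =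
      toLex (Fin.append n fun _ => 0) := by
  have hleft (i : Fin d) : Fin.castLE h (Fin.castAdd r i) = Fin.castAdd s i := rfl
  have hright (i : Fin r) : Fin.castLE h (Fin.natAdd d i) = Fin.natAdd d (i.castLE (by lia)) := rfl
  refine extendExponent_eq_of_forall _ (fun i => ?_) fun j hj => ?_
  · induction i using Fin.addCases with
    | left i => simp [hleft]
    | right i => simp [hright]
  · induction j using Fin.addCases with
    | left i => exact absurd ⟨Fin.castAdd r i, rfl⟩ hj
    | right i => simp

/-- The first coordinate where the exponents differ decides, so a variable is smaller than every
monomial in later variables, whatever the signs of its exponents. -/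
theorem extendExponent_lt_single (σ : Fin r ↪o Fin m) {j : Fin m} (h : ∀ i, j < σ i)
    (n : Lex (Fin r → ℤ)) : extendExponent σ n < toLex (Pi.single j 1) := by
  refine ⟨j, fun k hk => ?_, ?_⟩
  · refine (extendExponent_apply_of_notMem σ n ?_).trans
      (Pi.single_eq_of_ne (M := fun _ => ℤ) hk.ne 1).symm
    rintro ⟨i, rfl⟩
    exact absurd hk (h i).not_gt
  · refine (extendExponent_apply_of_notMem σ n ?_).trans_lt
      (zero_lt_one.trans_eq (Pi.single_eq_same (M := fun _ => ℤ) j 1).symm)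
    rintro ⟨i, hi⟩
    exact (h i).ne' hi

theorem one_sub_var_mul_extendVars_ne_zero (σ : Fin r ↪o Fin m) {j : Fin m} (h : ∀ i, j < σ i)
    (f : IteratedLaurent K r) : 1 - IteratedLaurent.var K j * extendVars K σ f ≠ 0 := by
  intro h0
  have h1 := congrArg (fun F : IteratedLaurent K m => F.coeff 0) h0
  simp only [HahnSeries.coeff_sub, IteratedLaurent.var,
    HahnSeries.coeff_single_mul, HahnSeries.coeff_zero, zero_sub, one_mul] at h1
  rw [coeff_extendVars_of_notMem, sub_zero] at h1
  · exact one_ne_zero ((HahnSeries.coeff_single_same 0 (1 : K)).symm.trans h1)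
  · rintro ⟨n, hn⟩
    have h2 := extendExponent_lt_single σ h (-n)
    rw [map_neg, hn, neg_neg] at h2
    exact lt_irrefl _ h2

theorem slice_div_one_sub (σ : Fin r ↪o Fin m) {j : Fin m} (h : ∀ i, j < σ i)
    (f : IteratedLaurent K r) (F : IteratedLaurent K m) (a : Lex (Fin m → ℤ)) :
    slice σ a (F / (1 - IteratedLaurent.var K j * extendVars K σ f)) =
      slice σ a F + f * slice σ (a - toLex (Pi.single j 1))
        (F / (1 - IteratedLaurent.var K j * extendVars K σ f)) := by
  have h0 := one_sub_var_mul_extendVars_ne_zero σ h f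
  set G := F / (1 - IteratedLaurent.var K j * extendVars K σ f) with hG
  have hF : F = G - extendVars K σ f * (HahnSeries.single (toLex (Pi.single j 1)) 1 * G) := by
    rw [eq_div_iff h0] at hG
    rw [← hG, IteratedLaurent.var]
    ring
  rw [hF, slice_sub, slice_extendVars_mul, slice_single_mul, sub_add_cancel]

/-- The slices of the quotient at `a - k • e_j` satisfy the same recurrence as `c`, and both vanish
for large `k`; descending induction from `k₀ + k₁` to `0` identifies them. -/
theorem slice_eq_of_recurrence (σ : Fin r ↪o Fin m) {j : Fin m} (h : ∀ i, j < σ i)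
    (f : IteratedLaurent K r) (F : IteratedLaurent K m) (a : Lex (Fin m → ℤ))
    (c : ℕ → IteratedLaurent K r)
    (hc : ∀ k, c k = slice σ (a - k • toLex (Pi.single j 1)) F + f * c (k + 1))
    (hc0 : ∃ k₀, ∀ k ≥ k₀, c k = 0) :
    slice σ a (F / (1 - IteratedLaurent.var K j * extendVars K σ f)) = c 0 := by
  set G := F / (1 - IteratedLaurent.var K j * extendVars K σ f)
  obtain ⟨k₀, hk₀⟩ := hc0
  obtain ⟨k₁, hk₁⟩ := exists_slice_eq_zero σ a (extendExponent_lt_single σ h) G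
  have key (k : ℕ) : slice σ (a - (k₀ + k₁ - k) • toLex (Pi.single j 1)) G = c (k₀ + k₁ - k) := by
    induction k with
    | zero => rw [hk₀ _ (by lia), hk₁ _ (by lia)]
    | succ k ih =>
      rcases lt_or_ge k (k₀ + k₁) with hk | hk
      · rw [hc, slice_div_one_sub σ h, sub_sub, ← succ_nsmul,
          show k₀ + k₁ - (k + 1) + 1 = k₀ + k₁ - k by lia, ih]
      · rwa [show k₀ + k₁ - (k + 1) = k₀ + k₁ - k by lia]
  have := key (k₀ + k₁)
  rwa [tsub_self, zero_smul, sub_zero] at this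

-- The series is $S\prod_{i\in s}(1-t_iR_i)^{-1}$, built one factor at a time, with $R_i$ the value
-- of `χ` at the basis vector $e_i$. Its coefficient of $t^n$, as a series in $z$, is $SR^n$ when
-- $n\in\mathbb N^d$ is supported in `s`, and $0$ otherwise.
open Classical in
theorem exists_slice_eq_geometric {S : IteratedLaurent K r} (hS : S ∈ rational K r)
    {χ : Multiplicative (ℕ → ℤ) →* IteratedLaurent K r} (hχ : IsRationalCharacter χ)
    (s : Finset (Fin d)) :
    ∃ F ∈ rational K (d + r), ∀ n : Fin d → ℤ,
      slice (Fin.natAddOrderEmb d) (extendExponent (Fin.castAddOrderEmb r) (toLex n)) F =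
        if (∀ i, 0 ≤ n i) ∧ ∀ i ∉ s, n i = 0 then S * χ (.ofAdd (extendIndex n)) else 0 := by
  have hlt (i : Fin d) (k : Fin r) : Fin.castAddOrderEmb r i < Fin.natAddOrderEmb d k := by
    rw [Fin.lt_def]
    simp
    lia
  induction s using Finset.induction_on with
  | empty =>
    refine ⟨extendVars K (Fin.natAddOrderEmb d) S, extendVars_mem_rational _ hS, fun n => ?_⟩
    ext k
    rw [coeff_slice]
    by_cases hn : n = 0
    · subst hn
      have h : extendIndex (0 : Fin d → ℤ) = 0 := (extendIndexHom d).map_zero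
      simp [coeff_extendVars, h]
    · rw [coeff_extendVars_of_notMem, if_neg fun h => hn (funext fun i => h.2 i (by simp))]
      · rfl
      · rintro ⟨l, hl⟩
        refine hn (funext fun i => ?_)
        have h := congrArg (fun x : Lex (Fin (d + r) → ℤ) => ofLex x (Fin.castAddOrderEmb r i)) hl
        have hi (l) : ofLex (extendExponent (Fin.natAddOrderEmb d) l)
            (Fin.castAddOrderEmb r i) = 0 := by
          refine extendExponent_apply_of_notMem _ _ ?_
          rintro ⟨k, hk⟩
          exact (hlt i k).ne' hk
        simp only [ofLex_add, Pi.add_apply, hi, extendExponent_apply] at h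
        simpa using h.symm
  | insert i s hi ih =>
    obtain ⟨F, hF, hn⟩ := ih
    refine ⟨_, div_mem hF (sub_mem (one_mem _) (mul_mem (var_mem_rational (Fin.castAddOrderEmb r i))
      (extendVars_mem_rational (Fin.natAddOrderEmb d)
        (hχ.mem (.ofAdd (extendIndex (Pi.single i 1))))))), fun n => ?_⟩
    have hE (k : ℕ) : extendExponent (Fin.castAddOrderEmb r) (toLex n) -
        k • toLex (Pi.single (Fin.castAddOrderEmb r i) 1) =
          extendExponent (Fin.castAddOrderEmb r) (toLex (n - k • Pi.single i 1)) := by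
      rw [← extendExponent_single, ← map_nsmul, ← map_sub]
      rfl
    set B : Prop := ∀ l ≠ i, 0 ≤ n l ∧ (l ∉ s → n l = 0) with hB
    have hinsert : ((∀ l, 0 ≤ n l) ∧ ∀ l ∉ insert i s, n l = 0) ↔ 0 ≤ n i ∧ B := by
      refine ⟨fun h => ⟨h.1 i, fun l hl => ⟨h.1 l, fun hls => h.2 l (by simp [hl, hls])⟩⟩,
        fun h => ⟨fun l => ?_, fun l hl => ?_⟩⟩
      · by_cases hl : l = i
        · exact hl ▸ h.1
        · exact (h.2 l hl).1
      · rw [Finset.mem_insert, not_or] at hl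
        exact (h.2 l hl.1).2 hl.2
    -- As `i ∉ s`, the previous series contains no $t_i$: its slice at $n-ke_i$ can be nonzero only
    -- for $k=n_i$.
    have hs (k : ℕ) : ((∀ l, 0 ≤ (n - k • Pi.single i 1 : Fin d → ℤ) l) ∧
        ∀ l ∉ s, (n - k • Pi.single i 1 : Fin d → ℤ) l = 0) ↔ n i - k = 0 ∧ B := by
      have hnk (l : Fin d) (hl : l ≠ i) : (n - k • Pi.single i 1 : Fin d → ℤ) l = n l := by
        simp [hl]
      have hni : (n - k • Pi.single i 1 : Fin d → ℤ) i = n i - k := by simp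
      refine ⟨fun h => ⟨hni ▸ h.2 i hi, fun l hl => hnk l hl ▸ ⟨h.1 l, h.2 l⟩⟩,
        fun h => ⟨fun l => ?_, fun l hls => ?_⟩⟩
      · by_cases hl : l = i
        · rw [hl, hni, h.1]
        · rw [hnk l hl]
          exact (h.2 l hl).1
      · by_cases hl : l = i
        · rw [hl, hni, h.1]
        · rw [hnk l hl]
          exact (h.2 l hl).2 hls
    -- The witness is the expected slice at $n-ke_i$. The previous series starts the recurrence at
    -- $k=n_i$, and each lower `k` multiplies by $R_i$.
    refine (slice_eq_of_recurrence _ (hlt i) _ F _ (fun k => if 0 ≤ n i - k ∧ B then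
      S * χ (.ofAdd (extendIndex (n - k • Pi.single i 1))) else 0) (fun k => ?_) ?_).trans ?_
    · rw [hE, hn]
      simp only [hs]
      have hstep : (n - k • Pi.single i 1 : Fin d → ℤ) =
          (n - (k + 1) • Pi.single i 1) + Pi.single i 1 := by
        rw [succ_nsmul]
        abel
      have hχk : χ (.ofAdd (extendIndex (n - k • Pi.single i 1))) =
          χ (.ofAdd (extendIndex (Pi.single i 1))) *
            χ (.ofAdd (extendIndex (n - (k + 1) • Pi.single i 1))) := by
        rw [hstep, extendIndex_add, ofAdd_add, map_mul, mul_comm]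
      by_cases hBn : B
      · simp only [hBn, and_true]
        rcases lt_trichotomy (n i - k) 0 with h | h | h
        · rw [if_neg (by lia), if_neg (by lia), if_neg (by push_cast; lia), mul_zero, zero_add]
        · rw [if_pos (by lia), if_pos h, if_neg (by push_cast; lia), mul_zero, add_zero]
        · rw [if_pos (by lia), if_neg (by lia), if_pos (by push_cast; lia), zero_add, hχk]
          ring
      · simp [hBn]
    · exact ⟨(n i).toNat + 1, fun k hk => if_neg fun h => by lia⟩
    · simp only [hinsert]
      simp

theorem IsGeometric.exists_generatingFunction {u : (ℕ → ℤ) → K} (hu : IsGeometric u) (d : ℕ) :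
    ∃ r, ∃ F ∈ rational K (d + r), ∀ n : Fin d → ℤ,
      F.coeffAt (Fin.append n (fun _ : Fin r => 0)) =
        extendByZero (fun k => u (extendIndex fun i => (k i : ℤ))) n := by
  obtain ⟨r, S, χ, hS, hχ, hu⟩ := hu
  obtain ⟨F, hF, h⟩ := exists_slice_eq_geometric (d := d) hS hχ Finset.univ
  refine ⟨r, F, hF, fun n => ?_⟩
  have h0 := coeff_slice (Fin.natAddOrderEmb d)
    (extendExponent (Fin.castAddOrderEmb r) (toLex n)) F 0
  rw [map_zero, add_zero, h, extendExponent_castAdd] at h0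
  refine h0.symm.trans ?_
  unfold extendByZero
  by_cases hn : ∀ i, 0 ≤ n i
  · rw [if_pos ⟨hn, by simp⟩, if_pos hn, ← hu]
    simp only [Int.toNat_of_nonneg (hn _)]
  · rw [if_neg (fun h => hn h.1), if_neg hn]
    rfl

theorem exists_generatingFunction {u : (ℕ → ℤ) → K} (hu : u ∈ constantTerms K) (d : ℕ) :
    ∃ r, ∃ F ∈ rational K (d + r), ∀ n : Fin d → ℤ,
      F.coeffAt (Fin.append n (fun _ : Fin r => 0)) =
        extendByZero (fun k => u (extendIndex fun i => (k i : ℤ))) n := by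
  induction hu using constantTerms_induction with
  | geometric u hu => exact hu.exists_generatingFunction d
  | zero => exact ⟨0, 0, zero_mem _, fun n => by simp [extendByZero, IteratedLaurent.coeffAt]⟩
  | add u v _ _ hu hv =>
    obtain ⟨r, F, hF, hu⟩ := hu
    obtain ⟨s, G, hG, hv⟩ := hv
    refine ⟨max r s, _, add_mem
      (extendVars_mem_rational (Fin.castLEOrderEmb (by simp)) hF)
      (extendVars_mem_rational (Fin.castLEOrderEmb (by simp)) hG), fun n => ?_⟩
    rw [IteratedLaurent.coeffAt, HahnSeries.coeff_add]
    have hF' := coeff_extendVars (Fin.castLEOrderEmb (m := d + max r s) (by simp)) F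
      (toLex (Fin.append n fun _ => 0))
    have hG' := coeff_extendVars (Fin.castLEOrderEmb (m := d + max r s) (by simp)) G
      (toLex (Fin.append n fun _ => 0))
    rw [extendExponent_castLE] at hF' hG'
    refine (congrArg₂ (· + ·) (hF'.trans (hu n)) (hG'.trans (hv n))).trans ?_
    unfold extendByZero
    split_ifs <;> simp
  | smul c u _ hu =>
    obtain ⟨r, F, hF, hu⟩ := hu
    refine ⟨r, _, IntermediateField.smul_mem _ hF (x := c), fun n => ?_⟩
    rw [IteratedLaurent.coeffAt, HahnSeries.coeff_smul]
    refine (congrArg (c • ·) (hu n)).trans ?_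
    unfold extendByZero
    split_ifs <;> simp

theorem IsNatBinomialSum.exists_generatingFunction {u : (Fin d → ℕ) → K}
    (hu : IsNatBinomialSum u) :
    ∃ (r : ℕ) (R : RationalFunction K (d + r)), ∀ n : Fin d → ℤ,
      extendByZero u n =
        (RationalFunction.expand R).coeffAt (Fin.append n (fun _ : Fin r => 0)) := by
  obtain ⟨v, hv, huv, -⟩ := hu
  obtain ⟨r, F, hF, h⟩ :=
    BinomialSums.exists_generatingFunction (binomialSums_le_constantTerms hv) d
  obtain ⟨R, rfl⟩ := mem_rational.1 hF
  refine ⟨r, R, fun n => ?_⟩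
  rw [h]
  congr 1
  ext k
  rw [liftSeq, restrictIndex_extendIndex, huv]

end GeneratingFunction

/-! ### Closure properties of binomial sums -/

section Closure

variable {K : Type*} [Field K] {d e : ℕ}

theorem isBinomialClosed_binomialSums (K : Type*) [Field K] :
    IsBinomialClosed (binomialSums K) :=
  (isLeast_binomialSums K).1.2

/-- A function on `ℤ^d` is affine. -/
def IsAffine (f : (Fin d → ℤ) → ℤ) : Prop :=
  ∃ g : (Fin d → ℤ) →ᵃ[ℤ] ℤ, ⇑g = f

theorem isAffine_linear (f : (Fin d → ℤ) →ₗ[ℤ] ℤ) : IsAffine f := ⟨f.toAffineMap, rfl⟩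

theorem isAffine_apply (i : Fin d) : IsAffine fun n => n i := isAffine_linear (LinearMap.proj i)

theorem isAffine_const (c : ℤ) : IsAffine fun _ : Fin d → ℤ => c := ⟨AffineMap.const ℤ _ c, rfl⟩

theorem IsAffine.sub {f g : (Fin d → ℤ) → ℤ} (hf : IsAffine f) (hg : IsAffine g) :
    IsAffine fun n => f n - g n := by
  obtain ⟨f, rfl⟩ := hf
  obtain ⟨g, rfl⟩ := hg
  exact ⟨f - g, rfl⟩

theorem IsAffine.mul_const {f : (Fin d → ℤ) → ℤ} (hf : IsAffine f) (c : ℤ) :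
    IsAffine fun n => f n * c := by
  obtain ⟨f, rfl⟩ := hf
  exact ⟨c • f, funext fun n => mul_comm _ _⟩

theorem IsBinomialSum.comp {u : (Fin e → ℤ) → K} (hu : IsBinomialSum u)
    {f : (Fin d → ℤ) → Fin e → ℤ} (hf : ∀ j, IsAffine fun n => f n j) :
    IsBinomialSum fun n => u (f n) := by
  choose g hg using hf
  have h := (isBinomialClosed_binomialSums K).affine d e (AffineMap.pi g) _ hu
  have hfg (n : Fin d → ℤ) : AffineMap.pi g n = f n := funext fun j => congrFun (hg j) n
  simpa only [restrictSeq, liftSeq, restrictIndex_extendIndex, hfg] using! h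

theorem IsBinomialSum.mul {u v : (Fin d → ℤ) → K} (hu : IsBinomialSum u) (hv : IsBinomialSum v) :
    IsBinomialSum fun n => u n * v n :=
  mul_mem (S := Subalgebra K _) hu hv

theorem isBinomialSum_const (c : K) : IsBinomialSum fun _ : Fin d → ℤ => c :=
  Subalgebra.algebraMap_mem (binomialSums K) c

theorem IsBinomialSum.sum {ι : Type*} (s : Finset ι) {u : ι → (Fin d → ℤ) → K}
    (hu : ∀ i ∈ s, IsBinomialSum (u i)) : IsBinomialSum fun n => ∑ i ∈ s, u i n := by
  have h : liftSeq (fun n => ∑ i ∈ s, u i n) = ∑ i ∈ s, liftSeq (u i) := by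
    ext x
    simp [liftSeq]
  rw [IsBinomialSum, h]
  exact sum_mem hu

theorem IsBinomialSum.prod {ι : Type*} (s : Finset ι) {u : ι → (Fin d → ℤ) → K}
    (hu : ∀ i ∈ s, IsBinomialSum (u i)) : IsBinomialSum fun n => ∏ i ∈ s, u i n := by
  have h : liftSeq (fun n => ∏ i ∈ s, u i n) = ∏ i ∈ s, liftSeq (u i) := by
    ext x
    simp [liftSeq]
  rw [IsBinomialSum, h]
  exact prod_mem hu

theorem IsAffine.isBinomialSum_delta {f : (Fin d → ℤ) → ℤ} (hf : IsAffine f) :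
    IsBinomialSum fun n => if f n = 0 then (1 : K) else 0 :=
  IsBinomialSum.comp (isBinomialClosed_binomialSums K).delta (f := fun n _ => f n) fun _ => hf

theorem IsAffine.isBinomialSum_zpow {f : (Fin d → ℤ) → ℤ} (hf : IsAffine f) {c : K} (hc : c ≠ 0) :
    IsBinomialSum fun n => c ^ f n :=
  IsBinomialSum.comp ((isBinomialClosed_binomialSums K).geom c hc) (f := fun n _ => f n) fun _ => hf

theorem IsAffine.isBinomialSum_intChoose {f g : (Fin d → ℤ) → ℤ} (hf : IsAffine f)
    (hg : IsAffine g) : IsBinomialSum fun n => ((intChoose (f n) (g n) : ℤ) : K) :=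
  IsBinomialSum.comp (isBinomialClosed_binomialSums K).binom (f := fun n => ![f n, g n])
    fun j => by fin_cases j <;> assumption

theorem IsBinomialSum.directedSum {u : (Fin (d + 1) → ℤ) → K} (hu : IsBinomialSum u)
    {f : (Fin d → ℤ) → ℤ} (hf : IsAffine f) :
    IsBinomialSum fun n => directedSum 0 (f n) fun k => u (Fin.snoc n k) := by
  have h := (isBinomialClosed_binomialSums K).sum d _ hu
  have h' := IsBinomialSum.comp h (d := d) (f := fun n => Fin.snoc n (f n)) fun j => by
    induction j using Fin.lastCases with
    | last => simpa using hf
    | cast i => simpa using isAffine_apply i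
  simpa [restrictSeq, liftSeq] using h'

/-- The indicator is $\sum'^{\,f(n)}_{k=0}\delta_k$: for negative $f(n)$ the directed sum only meets
negative `k`, where $\delta_k=0$. -/
theorem IsAffine.isBinomialSum_nonneg {f : (Fin d → ℤ) → ℤ} (hf : IsAffine f) :
    IsBinomialSum fun n => if 0 ≤ f n then (1 : K) else 0 := by
  have h := IsBinomialSum.directedSum (K := K) (isAffine_apply (Fin.last d)).isBinomialSum_delta hf
  convert h using 2 with n
  simp only [Fin.snoc_last, BinomialSums.directedSum, Finset.sum_ite_eq', Finset.mem_Icc]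
  split_ifs <;> first | rfl | (simp; done) | (exfalso; lia)

end Closure

/-! ### Coefficients of rational functions -/

section Coefficients

variable {K : Type*} [Field K] {m : ℕ}

theorem directedSum_zero_natCast {M : Type*} [AddCommGroup M] (N : ℕ) (f : ℤ → M) :
    directedSum 0 (N : ℤ) f = ∑ k ∈ Finset.range (N + 1), f k := by
  induction N with
  | zero => simp [directedSum]
  | succ N ih => rw [Nat.cast_succ, directedSum_zero_add_one, ih, Finset.sum_range_succ _ (N + 1),
      Nat.cast_succ]

/-- The coefficients of the powers of a Laurent polynomial, the exponent of the power being the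
last index. -/
noncomputable def powerCoeff (P : IteratedLaurent K m) : (Fin (m + 1) → ℤ) → K := fun x =>
  if 0 ≤ x (Fin.last m) then (P ^ (x (Fin.last m)).toNat).coeff (toLex (Fin.init x)) else 0

/-- Since $0^0=1$, the powers of $0$ give the Kronecker delta at the origin of $\mathbb Z^{m+1}$. -/
theorem isBinomialSum_powerCoeff_zero :
    IsBinomialSum (powerCoeff (0 : IteratedLaurent K m)) := by
  have h := IsBinomialSum.prod (K := K) Finset.univ (u := fun i (n : Fin (m + 1) → ℤ) =>
    if n i = 0 then 1 else 0) fun i _ => (isAffine_apply i).isBinomialSum_delta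
  convert h using 2 with n
  rw [Fin.prod_univ_castSucc, Finset.prod_ite_zero, powerCoeff]
  have h0 : toLex (Fin.init n) = 0 ↔ ∀ i ∈ Finset.univ, n (Fin.castSucc i) = 0 := by
    rw [← toLex_zero, toLex_inj, funext_iff]
    simp [Fin.init]
  rcases lt_trichotomy (n (Fin.last m)) 0 with hn | hn | hn
  · rw [if_neg (by lia), if_neg hn.ne, mul_zero]
  · rw [if_pos (by lia), if_pos hn, hn, Int.toNat_zero, pow_zero, HahnSeries.coeff_one]
    simp only [h0]
    simp
  · rw [if_pos hn.le, if_neg hn.ne', mul_zero, zero_pow (by lia), HahnSeries.coeff_zero]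

theorem coeff_add_single_pow (P : IteratedLaurent K m) (a g : Lex (Fin m → ℤ)) (c : K) (N : ℕ) :
    ((P + HahnSeries.single a c) ^ N).coeff g =
      ∑ k ∈ Finset.range (N + 1), (N.choose k : K) * c ^ k * (P ^ (N - k)).coeff (g - k • a) := by
  rw [add_comm P, add_pow, HahnSeries.coeff_sum]
  refine Finset.sum_congr rfl fun k _ => ?_
  rw [HahnSeries.single_pow, ← map_natCast (HahnSeries.C : K →+* IteratedLaurent K m),
    HahnSeries.C_apply, HahnSeries.coeff_mul_single_zero, HahnSeries.coeff_single_mul]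
  ring

theorem isBinomialSum_powerCoeff_add_single {P : IteratedLaurent K m}
    (hP : IsBinomialSum (powerCoeff P)) (a : Lex (Fin m → ℤ)) (c : K) :
    IsBinomialSum (powerCoeff (P + HahnSeries.single a c)) := by
  rcases eq_or_ne c 0 with rfl | hc
  -- Only nonzero `c` give geometric sequences.
  · simpa using hP
  have hN := isAffine_apply (Fin.castSucc (Fin.last m))
  have hk := isAffine_apply (Fin.last (m + 1))
  -- Here `y` lists the exponent $g$, the power $N$ and the summation index $k$; the sequence is the
  -- coefficient of $P^{N-k}$ at $g-ka$.
  have h₁ : IsBinomialSum fun y : Fin (m + 1 + 1) → ℤ => powerCoeff P (Fin.snoc (α := fun _ => ℤ)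
      (fun i => y (Fin.castSucc (Fin.castSucc i)) - y (Fin.last (m + 1)) * ofLex a i)
      (y (Fin.castSucc (Fin.last m)) - y (Fin.last (m + 1)))) :=
    hP.comp fun j => by
      induction j using Fin.lastCases with
      | last => simpa using hN.sub hk
      | cast i => simpa using (isAffine_apply _).sub (hk.mul_const _)
  -- The indicator of $N\ge0$ removes the values of the directed sum for negative $N$.
  have h := (IsAffine.isBinomialSum_nonneg (K := K) (isAffine_apply (Fin.last m))).mul
    ((((hN.isBinomialSum_intChoose hk).mul (hk.isBinomialSum_zpow hc)).mul h₁).directedSum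
      (isAffine_apply (Fin.last m)))
  convert h using 2 with n
  rw [powerCoeff]
  split_ifs with hn
  · obtain ⟨N, hN⟩ := Int.eq_ofNat_of_zero_le hn
    rw [one_mul, hN, directedSum_zero_natCast, Int.toNat_natCast, coeff_add_single_pow]
    refine Finset.sum_congr rfl fun k hk => ?_
    rw [Finset.mem_range] at hk
    simp only [Fin.snoc_last, Fin.snoc_castSucc, hN, zpow_natCast]
    congr 1
    · simp [intChoose, Ring.choose_natCast]
    · rw [powerCoeff, if_pos (by simp; lia)]
      simp only [Fin.snoc_last, Fin.init_snoc]
      rw [show ((N : ℤ) - k).toNat = N - k by lia]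
      rfl
  · rw [zero_mul]

theorem eq_sum_single_of_finite {f : IteratedLaurent K m} (hf : f.support.Finite) :
    f = ∑ a ∈ hf.toFinset, HahnSeries.single a (f.coeff a) := by
  classical
  ext g
  rw [HahnSeries.coeff_sum]
  simp only [HahnSeries.coeff_single]
  by_cases hg : f.coeff g = 0
  · rw [hg, Finset.sum_eq_zero]
    intro a _
    split_ifs with h
    · rw [← h, hg]
    · rfl
  · rw [Finset.sum_eq_single g]
    · simp
    · intro b _ hb
      rw [if_neg hb.symm]
    · intro h
      exact absurd (hf.mem_toFinset.2 hg) h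

theorem isBinomialSum_powerCoeff {P : IteratedLaurent K m} (hP : P.support.Finite) :
    IsBinomialSum (powerCoeff P) := by
  classical
  have h (s : Finset (Lex (Fin m → ℤ))) :
      IsBinomialSum (powerCoeff (∑ a ∈ s, HahnSeries.single a (P.coeff a))) := by
    induction s using Finset.induction_on with
    | empty => exact isBinomialSum_powerCoeff_zero
    | insert a s ha ih =>
      rw [Finset.sum_insert ha, add_comm (HahnSeries.single a _)]
      exact isBinomialSum_powerCoeff_add_single ih _ _
  rw [eq_sum_single_of_finite hP]
  exact h _

/-- By induction on `m`: a lexicographically positive vector has a positive first coordinate, or a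
zero one and a positive tail. A large enough weight `B` on the first coordinate outweighs the tails
of the first kind. -/
theorem exists_weight (s : Finset (Lex (Fin m → ℤ))) (hs : ∀ a ∈ s, 0 < a) :
    ∃ w : (Fin m → ℤ) →ₗ[ℤ] ℤ, ∀ a ∈ s, 1 ≤ w (ofLex a) := by
  classical
  induction m with
  | zero => exact ⟨0, fun a ha => absurd (hs a ha) (Subsingleton.elim a 0).not_gt⟩
  | succ m ih =>
    have hpos (a : Lex (Fin (m + 1) → ℤ)) (ha : 0 < a) :
        0 < ofLex a 0 ∨ ofLex a 0 = 0 ∧ 0 < toLex (Fin.tail (ofLex a)) := by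
      obtain ⟨i, hi, hlt⟩ := ha
      induction i using Fin.cases with
      | zero => exact .inl hlt
      | succ i =>
        exact .inr ⟨(hi 0 (Fin.succ_pos i)).symm, i, fun j hj => hi j.succ (by simpa using hj), hlt⟩
    obtain ⟨w, hw⟩ := ih ((s.filter fun a : Lex (Fin (m + 1) → ℤ) => ofLex a 0 = 0).image fun a =>
      toLex (Fin.tail (ofLex a))) (by
        intro b hb
        obtain ⟨a, ha, rfl⟩ := Finset.mem_image.1 hb
        rw [Finset.mem_filter] at ha
        rcases hpos a (hs a ha.1) with h | h
        · exact absurd ha.2 h.ne'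
        · exact h.2)
    set B : ℤ := 1 + ∑ a ∈ s, |w (Fin.tail (ofLex a))| with hB
    refine ⟨B • LinearMap.proj 0 + w.comp (LinearMap.funLeft ℤ ℤ Fin.succ), fun a ha => ?_⟩
    have hval : (B • LinearMap.proj 0 + w.comp (LinearMap.funLeft ℤ ℤ Fin.succ) :
        (Fin (m + 1) → ℤ) →ₗ[ℤ] ℤ) (ofLex a) = B * ofLex a 0 + w (Fin.tail (ofLex a)) := rfl
    rw [hval]
    rcases hpos a (hs a ha) with h | h
    · have h₁ := Finset.single_le_sum (f := fun a => |w (Fin.tail (ofLex a))|)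
        (fun _ _ => abs_nonneg _) ha
      have h₂ := neg_abs_le (w (Fin.tail (ofLex a)))
      have h₃ : B ≤ B * ofLex a 0 :=
        le_mul_of_one_le_right ((abs_nonneg _).trans (h₁.trans (by lia))) h
      lia
    · have := hw _ (Finset.mem_image_of_mem _ (Finset.mem_filter.2 ⟨ha, h.1⟩))
      rw [h.1, mul_zero, zero_add]
      exact this

/-- An exponent of `P ^ N` is a sum of `N` exponents of `P`, each of weight at least $1$. -/
theorem le_weight_of_coeff_pow_ne_zero {P : IteratedLaurent K m} {w : (Fin m → ℤ) →ₗ[ℤ] ℤ}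
    (hw : ∀ a ∈ P.support, 1 ≤ w (ofLex a)) (N : ℕ) {g : Lex (Fin m → ℤ)}
    (hg : g ∈ (P ^ N).support) : (N : ℤ) ≤ w (ofLex g) := by
  induction N generalizing g with
  | zero =>
    rw [pow_zero, HahnSeries.support_one, Set.mem_singleton_iff] at hg
    simp [hg]
  | succ N ih =>
    rw [pow_succ] at hg
    obtain ⟨a, ha, b, hb, rfl⟩ := HahnSeries.support_mul_subset hg
    have h₁ := ih ha
    have h₂ := hw b hb
    simp only [ofLex_add, map_add]
    push_cast
    lia

theorem isBinomialSum_coeff_inv_one_sub {P : IteratedLaurent K m} (hP : P.support.Finite)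
    (hpos : ∀ a ∈ P.support, 0 < a) :
    IsBinomialSum fun n => ((1 - P)⁻¹).coeff (toLex n) := by
  obtain ⟨w, hw⟩ := exists_weight hP.toFinset fun a ha => hpos a (hP.mem_toFinset.1 ha)
  replace hw : ∀ a ∈ P.support, 1 ≤ w (ofLex a) := fun a ha => hw a (hP.mem_toFinset.2 ha)
  have horder : 0 < P.orderTop := by
    rcases eq_or_ne P 0 with rfl | h0
    · simp
    · exact HahnSeries.zero_lt_orderTop_of_order
        (hpos _ (HahnSeries.coeff_order_eq_zero.not.2 h0))
  have hinv : (1 - P)⁻¹ = (HahnSeries.SummableFamily.powers P).hsum :=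
    inv_eq_of_mul_eq_one_right (HahnSeries.SummableFamily.one_sub_self_mul_hsum_powers horder)
  have h := (IsAffine.isBinomialSum_nonneg (K := K) (isAffine_linear w)).mul
    ((isBinomialSum_powerCoeff hP).directedSum (isAffine_linear w))
  convert h using 2 with n
  -- Only the powers $k\le w(n)$ reach the exponent `n`, and none does if $w(n)<0$; hence the
  -- indicator in front of the directed sum.
  rw [hinv, HahnSeries.SummableFamily.coeff_hsum_eq_sum_of_subset
    (t := if 0 ≤ w n then Finset.range ((w n).toNat + 1) else ∅)]
  · split_ifs with hn
    · obtain ⟨N, hN⟩ := Int.eq_ofNat_of_zero_le hn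
      rw [hN, one_mul, directedSum_zero_natCast, Int.toNat_natCast]
      refine Finset.sum_congr rfl fun k _ => ?_
      rw [HahnSeries.SummableFamily.powers_of_orderTop_pos horder, powerCoeff]
      simp
    · simp
  · intro k hk
    rw [Set.mem_ofPred_eq, HahnSeries.SummableFamily.powers_of_orderTop_pos horder] at hk
    have h := le_weight_of_coeff_pow_ne_zero hw k hk
    rw [ofLex_toLex] at h
    rw [if_pos (by lia)]
    simp
    lia

theorem isBinomialSum_coeff_mul {f G : IteratedLaurent K m} (hf : f.support.Finite)
    (hG : IsBinomialSum fun n => G.coeff (toLex n)) :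
    IsBinomialSum fun n => (f * G).coeff (toLex n) := by
  have h := IsBinomialSum.sum hf.toFinset (u := fun a n => f.coeff a * G.coeff (toLex n - a))
    fun a _ => (isBinomialSum_const _).mul
      (hG.comp (f := fun n => n - ofLex a) fun j => (isAffine_apply j).sub (isAffine_const _))
  convert h using 2 with n
  conv_lhs => rw [eq_sum_single_of_finite hf, Finset.sum_mul, HahnSeries.coeff_sum]
  exact Finset.sum_congr rfl fun a _ => HahnSeries.coeff_single_mul

theorem finite_support_polyToLaurent (p : MvPolynomial (Fin m) K) :
    (polyToLaurent K m p).support.Finite := by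
  induction p using MvPolynomial.induction_on' with
  | monomial s c =>
    rw [polyToLaurent_monomial]
    exact (Set.finite_singleton _).subset HahnSeries.support_single_subset
  | add p q hp hq =>
    rw [map_add]
    exact (hp.union hq).subset (HahnSeries.support_add_subset _ _)

theorem finite_support_single_mul {f : IteratedLaurent K m} (hf : f.support.Finite)
    (a : Lex (Fin m → ℤ)) (c : K) : (HahnSeries.single a c * f).support.Finite := by
  refine (((Set.finite_singleton a).subset HahnSeries.support_single_subset).add hf).subset
    HahnSeries.support_mul_subset

/-- With `M` the inverse of the leading term of `Q`, all exponents of $1-MQ$ are positive, and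
$Q^{-1}=M\,(1-(1-MQ))^{-1}$. -/
theorem isBinomialSum_coeff_inv {Q : IteratedLaurent K m} (hQ : Q.support.Finite) (hQ0 : Q ≠ 0) :
    IsBinomialSum fun n => (Q⁻¹).coeff (toLex n) := by
  set M : IteratedLaurent K m := HahnSeries.single (-Q.order) Q.leadingCoeff⁻¹ with hM
  have hlc : Q.leadingCoeff ≠ 0 := HahnSeries.leadingCoeff_ne_zero.2 hQ0
  have hM0 : M ≠ 0 := HahnSeries.single_ne_zero (inv_ne_zero hlc)
  have hfin : (1 - M * Q).support.Finite := by
    rw [sub_eq_add_neg]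
    refine (Set.Finite.union ?_ ?_).subset (HahnSeries.support_add_subset _ _)
    · rw [HahnSeries.support_one]
      exact Set.finite_singleton 0
    · rw [HahnSeries.support_neg]
      exact finite_support_single_mul hQ _ _
  have hpos : ∀ a ∈ (1 - M * Q).support, 0 < a := by
    intro a ha
    rw [HahnSeries.mem_support, HahnSeries.coeff_sub, hM, HahnSeries.coeff_single_mul,
      sub_neg_eq_add] at ha
    by_contra h
    rcases (not_lt.1 h).lt_or_eq with h | rfl
    · rw [HahnSeries.coeff_one, if_neg h.ne, HahnSeries.coeff_eq_zero_of_lt_order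
        (add_lt_of_neg_left _ h)] at ha
      simp at ha
    · rw [HahnSeries.coeff_one, if_pos rfl, zero_add, HahnSeries.leadingCoeff_eq,
        inv_mul_cancel₀ (HahnSeries.coeff_order_eq_zero.not.2 hQ0), sub_self] at ha
      exact ha rfl
  have h := isBinomialSum_coeff_mul
    ((Set.finite_singleton _).subset HahnSeries.support_single_subset)
    (f := M) (isBinomialSum_coeff_inv_one_sub hfin hpos)
  convert h using 4 with n
  rw [sub_sub_cancel, mul_inv, mul_inv_cancel_left₀ hM0]

theorem isBinomialSum_coeffAt_expand (R : RationalFunction K m) :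
    IsBinomialSum fun n => (RationalFunction.expand R).coeffAt n := by
  obtain ⟨p, q, hq, h⟩ := exists_expand_eq_div R
  rw [h, div_eq_mul_inv]
  refine isBinomialSum_coeff_mul (finite_support_polyToLaurent p)
    (isBinomialSum_coeff_inv (finite_support_polyToLaurent q) ?_)
  rwa [Ne, map_eq_zero_iff _ (polyToLaurent_injective K m)]

theorem isNatBinomialSum_of_generatingFunction {d r : ℕ} {u : (Fin d → ℕ) → K}
    {R : RationalFunction K (d + r)}
    (h : ∀ n : Fin d → ℤ, extendByZero u n =
      (RationalFunction.expand R).coeffAt (Fin.append n (fun _ : Fin r => 0))) :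
    IsNatBinomialSum u := by
  refine ⟨extendByZero u, ?_, fun n => ?_, fun n hn => ?_⟩
  -- Taking $[z^0]$ is the affine substitution $n\mapsto(n,0)$.
  · have hR := (isBinomialSum_coeffAt_expand R).comp
      (f := fun n : Fin d → ℤ => Fin.append n (fun _ : Fin r => 0)) fun j => by
        induction j using Fin.addCases with
        | left i => simpa using isAffine_apply i
        | right i => simpa using isAffine_const 0
    rwa [show extendByZero u = _ from funext h]
  · simp [extendByZero]
  · by_contra hneg
    exact hn (if_neg hneg)

end Coefficients

end BinomialSums

open BinomialSums in
theorem mainTheorem5 {K : Type*} [Field K] [CharZero K] (d : ℕ) (hd : 1 ≤ d)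
    (u : (Fin d → ℕ) → K) :
    IsNatBinomialSum u ↔
      ∃ (r : ℕ) (R : RationalFunction K (d + r)), ∀ n : Fin d → ℤ,
        extendByZero u n =
          (RationalFunction.expand R).coeffAt (Fin.append n (fun _ : Fin r => 0)) :=
  ⟨IsNatBinomialSum.exists_generatingFunction,
    fun ⟨_, _, h⟩ => isNatBinomialSum_of_generatingFunction h⟩
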